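/- Let $g\ge 2$. On $V=\mathbb{Q}[x_1,x_2,\ldots]$, graded by $\deg x_i=i$, with $\partial_i=\partial/\partial x_i$, put $$D=-g\,\partial_1+\frac12\sum_{m,n\ge 1}\binom{m+n}{m}x_{m+n-1}\partial_m\partial_n .$$ Let $I_g\subset V$ be the $\mathbb{Q}$-linear span of all homogeneous polynomials of degree $>g$ and of all polynomials $D^d(x_1^{m_1}\cdots x_k^{m_k})$ with $d\ge 0$, $m_1+2m_2+\cdots+km_k=g$ and $m_1<g$. Let $R_g^{\mathrm{Jac}}=V/I_g$, and write $p_1^{n}p_{n_1}\cdots p_{n_k}$ for the image in $R_g^{\mathrm{Jac}}$ of $x_1^{n}x_{n_1}\cdots x_{n_k}$. Put $x_1^{[a]}=x_1^a/a!$ for $a\ge 0$ and $x_1^{[a]}=0$ for $a<0$, and similarly for $p_1^{[a]}$. Then: (i) $I_g=\bigcap_{n\ge 1}\operatorname{im}(D^n)$, where $\operatorname{im}(D^n)$ is the image of $D^n$ acting on $V$. (ii) $I_g$ is an ideal of $V$, so $R_g^{\mathrm{Jac}}$ is a commutative ring. (iii) There is a unique linear operator $S$ on $R_g^{\mathrm{Jac}}$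 such that for all $n,k\ge 0$ and all $n_1,\ldots,n_k>1$ $$(-1)^nS\bigl(p_1^{[n]}p_{n_1}\cdots p_{n_k}\bigr)=\sum_{\{1,\ldots,k\}=J_1\sqcup\cdots\sqcup J_m}b(J_1)\cdots b(J_m)\,p_1^{[g-n-m-\sum_i n_i]}\,p_{d(J_1)}\cdots p_{d(J_m)},$$ the sum being over all unordered partitions of $\{1,\ldots,k\}$ into nonempty subsets, with $b(J)=\bigl(\sum_{i\in J}n_i\bigr)!\big/\prod_{i\in J}n_i!$ and $d(J)=\sum_{i\in J}n_i-|J|+1$. It satisfies, for all $n,k\ge 0$ and all $n_1,\ldots,n_k>1$, $$S^2(p_1^np_{n_1}\cdots p_{n_k})=(-1)^{g+k+\sum_i n_i}\,p_1^np_{n_1}\cdots p_{n_k}.$$ (iv) The operators $e(F)=x_1F$, $f=-D$ and $h=-g+\sum_{n\ge 1}(n+1)x_n\partial_n$ on $V$ define a representation of the Lie algebra $\mathfrak{sl}_2$ (with $e,f,h$ the images of the standard basis). They preserve $I_g$ and hence define a representation of $\mathfrak{sl}_2$ on $R_g^{\mathrm{Jac}}$. The operator $S$ is invertible, and on $R_g^{\mathrm{Jac}}$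 one has $SeS^{-1}=-f$, $SfS^{-1}=-e$ and $ShS^{-1}=-h$. -/

import Mathlib

attribute [local instance] LieRing.ofAssociativeRing

namespace JacobianRing

noncomputable section

/-- The polynomial ring `ℚ[x₁, x₂, …]` in countably many variables. -/
abbrev Poly : Type := MvPolynomial ℕ+ ℚ

/-- The variable `x_n`, for a natural number `n ≥ 1`. -/
def x (n : ℕ) : Poly := MvPolynomial.X n.toPNat'

/-- The partial derivative `∂_n`. -/
def pd (n : ℕ+) : Poly →ₗ[ℚ] Poly := (MvPolynomial.pderiv n).toLinearMap

lemma pd_eq_zero {n : ℕ+} {F : Poly} (h : n ∉ F.vars) : pd n F = 0 :=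
  MvPolynomial.pderiv_eq_zero_of_notMem_vars h

lemma pd_comm (m n : ℕ+) (F : Poly) : pd m (pd n F) = pd n (pd m F) := by
  have h : ⁅(MvPolynomial.pderiv m : Derivation ℚ Poly Poly),
      (MvPolynomial.pderiv n : Derivation ℚ Poly Poly)⁆ = 0 := by
    apply MvPolynomial.derivation_ext
    intro i
    simp only [Derivation.commutator_apply, MvPolynomial.pderiv_X, Derivation.zero_apply,
      Pi.single_apply]
    split_ifs <;> simp
  have h2 := congrArg (fun d : Derivation ℚ Poly Poly => d F) h
  simp only [Derivation.commutator_apply, Derivation.zero_apply] at h2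
  exact sub_eq_zero.mp h2

lemma finite_support_first (c : ℕ+ → Poly) (F : Poly) :
    (Function.support fun n : ℕ+ => c n * pd n F).Finite := by
  refine F.vars.finite_toSet.subset fun n hn => ?_
  by_contra h
  exact hn (by simp only [pd_eq_zero h, mul_zero])

lemma finite_support_second (c : ℕ+ × ℕ+ → Poly) (F : Poly) :
    (Function.support fun p : ℕ+ × ℕ+ => c p * pd p.1 (pd p.2 F)).Finite := by
  refine (F.vars ×ˢ F.vars).finite_toSet.subset fun p hp => ?_
  by_contra h
  apply hp
  rw [Finset.mem_coe, Finset.mem_product, not_and_or] at h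
  rcases h with h | h
  · simp only [pd_comm p.1, pd_eq_zero h, map_zero, mul_zero]
  · simp only [pd_eq_zero h, map_zero, mul_zero]

/-- The first order differential operator `∑_{n ≥ 1} c_n ∂_n`. -/
def diffOp₁ (c : ℕ+ → Poly) : Poly →ₗ[ℚ] Poly where
  toFun F := ∑ᶠ n : ℕ+, c n * pd n F
  map_add' F G := by
    simp only [map_add, mul_add]
    exact finsum_add_distrib (finite_support_first c F) (finite_support_first c G)
  map_smul' a F := by
    simp only [map_smul, mul_smul_comm, RingHom.id_apply]
    exact (smul_finsum' a (finite_support_first c F)).symm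

/-- The second order differential operator `∑_{m, n ≥ 1} c_{m,n} ∂_m ∂_n`. -/
def diffOp₂ (c : ℕ+ × ℕ+ → Poly) : Poly →ₗ[ℚ] Poly where
  toFun F := ∑ᶠ p : ℕ+ × ℕ+, c p * pd p.1 (pd p.2 F)
  map_add' F G := by
    simp only [map_add, mul_add]
    exact finsum_add_distrib (finite_support_second c F) (finite_support_second c G)
  map_smul' a F := by
    simp only [map_smul, mul_smul_comm, RingHom.id_apply]
    exact (smul_finsum' a (finite_support_second c F)).symm

/-- `D = -g ∂₁ + (1/2) ∑_{m, n ≥ 1} (m+n choose m) x_{m+n-1} ∂_m ∂_n`. -/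
def D (g : ℕ) : Module.End ℚ Poly :=
  -(g : ℚ) • pd 1 +
    (1 / 2 : ℚ) • diffOp₂ fun p => (Nat.choose (p.1 + p.2) p.1 : ℚ) • x ((p.1 : ℕ) + p.2 - 1)

/-- `e(F) = x₁ F`. -/
def eOp : Module.End ℚ Poly := LinearMap.mulLeft ℚ (x 1)

/-- `f = -D`. -/
def fOp (g : ℕ) : Module.End ℚ Poly := -D g

/-- `h = -g + ∑_{n ≥ 1} (n+1) x_n ∂_n`. -/
def hOp (g : ℕ) : Module.End ℚ Poly :=
  -(g : ℚ) • LinearMap.id + diffOp₁ fun n => ((n : ℚ) + 1) • x n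

/-- The grading `deg x_i = i`. -/
def wt (i : ℕ+) : ℕ := i

/-- `I_g`: the span of the `D^d (x₁^{m₁} ⋯ x_k^{m_k})` with `d ≥ 0`, `∑ i m_i = g`, `m₁ < g`,
and of the homogeneous polynomials of degree `> g`. -/
def I (g : ℕ) : Submodule ℚ Poly :=
  Submodule.span ℚ
    ({F | ∃ (d : ℕ) (m : ℕ+ →₀ ℕ), Finsupp.weight wt m = g ∧ m 1 < g ∧
        F = (D g ^ d) (MvPolynomial.monomial m 1)} ∪
      {F | ∃ n > g, MvPolynomial.IsWeightedHomogeneous wt F n})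

/-- `R_g = ℚ[x₁, x₂, …] / I_g`, as a quotient vector space. -/
abbrev R (g : ℕ) : Type := Poly ⧸ I g

/-- `x₁^{[a]} = x₁^a / a!` for `a ≥ 0`, and `0` for `a < 0`. -/
def x₁div (a : ℤ) : Poly := if 0 ≤ a then (1 / (Nat.factorial a.toNat : ℚ)) • x 1 ^ a.toNat else 0

/-- `b(J) = (∑_{i ∈ J} n_i)! / ∏_{i ∈ J} n_i!`. -/
def b {k : ℕ} (ν : Fin k → ℕ) (J : Finset (Fin k)) : ℚ :=
  (Nat.factorial (∑ i ∈ J, ν i) : ℚ) / ∏ i ∈ J, (Nat.factorial (ν i) : ℚ)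

/-- `d(J) = ∑_{i ∈ J} n_i - |J| + 1` (nonnegative when all `n_i ≥ 1`). -/
def dIdx {k : ℕ} (ν : Fin k → ℕ) (J : Finset (Fin k)) : ℕ := ∑ i ∈ J, ν i + 1 - J.card

/-- The sum, over all unordered partitions `{1, …, k} = J₁ ⊔ … ⊔ J_m` into nonempty subsets, of
`b(J₁) ⋯ b(J_m) x₁^{[g - n - m - ∑ n_i]} x_{d(J₁)} ⋯ x_{d(J_m)}`. -/
def fourierSum (g n : ℕ) {k : ℕ} (ν : Fin k → ℕ) : Poly :=
  ∑ P : Finpartition (Finset.univ : Finset (Fin k)),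
    (∏ J ∈ P.parts, b ν J) •
      (x₁div ((g : ℤ) - n - P.parts.card - ∑ i, (ν i : ℤ)) * ∏ J ∈ P.parts, x (dIdx ν J))

/-- The linear operator `S` on `R_g` satisfies the explicit formula
`(-1)^n S(p₁^{[n]} p_{n₁} ⋯ p_{n_k}) = ∑ b(J₁) ⋯ b(J_m) p₁^{[g-n-m-∑ n_i]} p_{d(J₁)} ⋯ p_{d(J_m)}`
for all `n ≥ 0`, `k ≥ 0` and `n₁, …, n_k > 1`. -/
def FourierFormula (g : ℕ) (S : R g →ₗ[ℚ] R g) : Prop :=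
  ∀ (n k : ℕ) (ν : Fin k → ℕ), (∀ i, 1 < ν i) →
    (-1 : ℚ) ^ n • S ((I g).mkQ (x₁div n * ∏ i, x (ν i))) = (I g).mkQ (fourierSum g n ν)

/-- The Lie algebra `sl₂` of traceless `2 × 2` matrices. -/
abbrev sl₂ : Type := LieAlgebra.SpecialLinear.sl (Fin 2) ℚ

/-- The matrix `e = !![0, 1; 0, 0]`. -/
def E : sl₂ := LieAlgebra.SpecialLinear.single 0 1 (by decide) 1

/-- The matrix `f = !![0, 0; 1, 0]`. -/
def Fm : sl₂ := LieAlgebra.SpecialLinear.single 1 0 (by decide) 1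

/-- The matrix `h = !![1, 0; 0, -1]`. -/
def H : sl₂ := LieAlgebra.SpecialLinear.singleSubSingle 0 1 1

end

end JacobianRing

open MvPolynomial

namespace JacobianRing

noncomputable section

/-! Multiplication by variables, `hOp` and `D` all come from one Lie algebra. The operators `O i m`
bracket like the functions $t^m\varphi^i$ under the Poisson bracket in $(t,\varphi)$
(`commutator_O_O`). Up to scalars, `O 0 (k+1)` is multiplication by $x_k$, `O 1 1` is $h+g$, and `O
2 0` is the second order part of $2D$. Hence $x_1,-D,h$ satisfy the $\mathfrak{sl}_2$ relations, and
$\operatorname{ad} D$ is nilpotent on multiplication by $x_k$, $k\ge 2$. It follows that $\bigcap_n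
\operatorname{im} D^n$ is an ideal (`mul_mem_imD`).

Let $w$ be a product of $k$ variables other than $x_1$, with $hw=-cw$. Then
$D(x_1^{[a]}w)=(a-1-c)x_1^{[a-1]}w+x_1^{[a]}Dw$ and $D$ is nilpotent on $w$. Solving this recursion
puts every monomial of degree $\ge g$ except $x_1^g$ into all images. Conversely $D$ lowers degree
by one and never produces $x_1^g$, so the image of $D^{g+1}$ already lies in $I_g$. This is (i), and
(ii) follows.

Each application of $D$ to $w$ merges two factors, and $D^j w/j!$ is the sum over set partitions
into $k-j$ blocks (`D_pow_prod`). The formula for $S$ therefore reads $S(x_1^{[n]}w)=(-1)^n\sum_j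
x_1^{[c-n+j]}D^jw/j!$, a truncated exponential (`fourierSum_eq_expSum`). For this lift of $S$ to
polynomials, $Sx_1=DS$ and $hS=-Sh$ hold exactly, while $SD=x_1S$ holds modulo $I_g$, the defect
being $D$-divisible to all orders (`fourier_D_sub_mem`). So $S$ descends to the quotient and
conjugates the $\mathfrak{sl}_2$-action as claimed.

Finally $S^2$ commutes with $x_1$ modulo $I_g$. On $w$ with $c\ge 0$ an alternating binomial sum
gives $S^2w=(-1)^cw$, which settles $h$-weights $\le 0$. Since $x_1$ is nilpotent on the quotient,
every vector of positive weight is $x_1$ times a vector of weight two less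
(`exists_sub_x_one_mul_mem`), and induction on the weight finishes. -/

/-- Multiplication by the variable `x_k`, for `k : ℕ+`. -/
def mulX (k : ℕ+) : Module.End ℚ Poly := LinearMap.mulLeft ℚ (X k)

lemma mulX_apply (k : ℕ+) (F : Poly) : mulX k F = X k * F := rfl

/-! ### Commutators of operators on polynomials -/

/-- The commutator of two operators. -/
def commutator (A B : Module.End ℚ Poly) : Module.End ℚ Poly := A * B - B * A

lemma commutator_smul_left (c : ℚ) (A B : Module.End ℚ Poly) :
    commutator (c • A) B = c • commutator A B := by
  simp only [commutator, smul_sub, smul_mul_assoc, mul_smul_comm]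

lemma commutator_smul_right (c : ℚ) (A B : Module.End ℚ Poly) :
    commutator A (c • B) = c • commutator A B := by
  simp only [commutator, smul_sub, smul_mul_assoc, mul_smul_comm]

lemma commutator_add_left (A B C : Module.End ℚ Poly) :
    commutator (A + B) C = commutator A C + commutator B C := by
  unfold commutator; noncomm_ring

lemma commutator_sub_left (A B C : Module.End ℚ Poly) :
    commutator (A - B) C = commutator A C - commutator B C := by
  simp only [commutator, sub_mul, mul_sub]; abel

lemma commutator_zero_left (A : Module.End ℚ Poly) : commutator 0 A = 0 := by simp [commutator]

lemma commutator_one_left (A : Module.End ℚ Poly) : commutator 1 A = 0 := by simp [commutator]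

lemma commutator_swap (A B : Module.End ℚ Poly) : commutator A B = (-1 : ℚ) • commutator B A := by
  refine LinearMap.ext fun F => ?_
  simp [commutator]

lemma commutator_commutator (A B C : Module.End ℚ Poly) :
    commutator (commutator A B) C =
      commutator (commutator A C) B + commutator A (commutator B C) := by
  simp only [commutator, sub_mul, mul_sub, mul_assoc]; abel

lemma x_pnat (k : ℕ+) : x (k : ℕ) = X k := by simp [x]

lemma x_of_pos {n : ℕ} (h : 0 < n) : x n = X (⟨n, h⟩ : ℕ+) := x_pnat ⟨n, h⟩

lemma pd_X_mul (n k : ℕ+) (F : Poly) :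
    pd n (X k * F) = (if n = k then F else 0) + X k * pd n F := by
  simp only [pd, Derivation.coeFn_coe, Derivation.leibniz, pderiv_X, smul_eq_mul, Pi.single_apply]
  split_ifs <;> simp_all [add_comm]

lemma pd_one (n : ℕ+) : pd n 1 = 0 := by simp [pd]

/-- Polynomials arise from $1$ by multiplying with variables and taking linear combinations.
Operator identities thus reduce to the value at $1$ and the commutators with variables. -/
lemma end_eq_zero {Z : Module.End ℚ Poly} (h1 : Z 1 = 0)
    (hX : ∀ k, commutator Z (mulX k) = 0) : Z = 0 := by
  have hX' : ∀ k F, Z (X k * F) = X k * Z F := fun k F => by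
    have := LinearMap.congr_fun (hX k) F
    simpa [commutator, sub_eq_zero, mulX_apply] using this
  refine LinearMap.ext fun F => ?_
  induction F using MvPolynomial.induction_on with
  | C a => rw [← mul_one (C a), ← smul_eq_C_mul, map_smul, h1]; simp
  | add F G hF hG => rw [map_add, hF, hG]; simp
  | mul_X F k hF => rw [mul_comm, hX', hF]; simp

/-! ### The operators `O i m` and their Lie algebra -/

/-- The locally finite sum `∑ A_n ∂_n` of operators. -/
def sumPd (A : ℕ+ → Module.End ℚ Poly) : Module.End ℚ Poly where
  toFun F := ∑ᶠ n : ℕ+, A n (pd n F)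
  map_add' F G := by
    have hf : ∀ F : Poly, (Function.support fun n : ℕ+ => A n (pd n F)).Finite := fun F =>
      F.vars.finite_toSet.subset fun n hn => by
        by_contra h
        exact hn (by simp only [pd_eq_zero h, map_zero])
    simp only [map_add]
    exact finsum_add_distrib (hf F) (hf G)
  map_smul' a F := by
    have hf : (Function.support fun n : ℕ+ => A n (pd n F)).Finite :=
      F.vars.finite_toSet.subset fun n hn => by
        by_contra h
        exact hn (by simp only [pd_eq_zero h, map_zero])
    simp only [map_smul, RingHom.id_apply]
    exact (smul_finsum' a hf).symm

lemma sumPd_apply_of_forall (A : ℕ+ → Module.End ℚ Poly) (F : Poly) {s : Finset ℕ+}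
    (h : ∀ n ∉ s, pd n F = 0) : sumPd A F = ∑ n ∈ s, A n (pd n F) := by
  refine finsum_eq_sum_of_support_subset _ fun n hn => ?_
  by_contra h'
  exact hn (by simp only [h n h', map_zero])

lemma sumPd_apply_of_subset (A : ℕ+ → Module.End ℚ Poly) (F : Poly) {s : Finset ℕ+}
    (h : F.vars ⊆ s) : sumPd A F = ∑ n ∈ s, A n (pd n F) :=
  sumPd_apply_of_forall A F fun _ hn => pd_eq_zero fun h' => hn (h h')

lemma sumPd_one (A : ℕ+ → Module.End ℚ Poly) : sumPd A 1 = 0 := by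
  rw [sumPd_apply_of_subset A 1 (s := ∅) (by simp)]; simp

lemma commutator_sumPd_mulX (A : ℕ+ → Module.End ℚ Poly) (k : ℕ+) :
    commutator (sumPd A) (mulX k) = A k + sumPd fun n => commutator (A n) (mulX k) := by
  refine LinearMap.ext fun F => ?_
  simp only [commutator, LinearMap.sub_apply, LinearMap.add_apply,
    Module.End.mul_apply, mulX_apply]
  have h1 : (X k * F).vars ⊆ F.vars ∪ {k} := (vars_mul _ _).trans (by
    rw [vars_X, Finset.union_comm])
  have h2 : F.vars ⊆ F.vars ∪ {k} := Finset.subset_union_left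
  rw [sumPd_apply_of_subset _ _ h1, sumPd_apply_of_subset _ _ h2, sumPd_apply_of_subset _ _ h2]
  simp only [pd_X_mul, map_add, Finset.sum_add_distrib, LinearMap.sub_apply, Module.End.mul_apply,
    mulX_apply, Finset.sum_sub_distrib, Finset.mul_sum]
  rw [Finset.sum_eq_single k]
  · simp [add_sub_assoc]
  · intro b _ hb; simp [hb]
  · intro h; simp at h

/-- The operators which act on `exp (∑ aₙ n! xₙ)` by multiplication with the value at
`(t^m φ(t)^i)'`, `φ = ∑ aₙ tⁿ`, of the linear map with `tⁿ ↦ n! xₙ`. -/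
def O : ℕ → ℕ → Module.End ℚ Poly
  | 0, m => (m.factorial : ℚ) • LinearMap.mulLeft ℚ (x (m - 1))
  | i + 1, m => sumPd fun n => (1 / (n : ℕ).factorial : ℚ) • O i (m + n)

lemma O_zero_succ (k : ℕ+) : O 0 (k + 1) = ((k + 1 : ℕ).factorial : ℚ) • mulX k := by
  simp [O, x_pnat, mulX]

lemma O_succ (i m : ℕ) :
    O (i + 1) m = sumPd fun n => (1 / (n : ℕ).factorial : ℚ) • O i (m + n) := rfl

lemma O_succ_one (i m : ℕ) : O (i + 1) m 1 = 0 := sumPd_one _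

lemma commutator_O_zero_mulX (m : ℕ) (k : ℕ+) : commutator (O 0 m) (mulX k) = 0 := by
  refine LinearMap.ext fun F => ?_
  simp [commutator, mulX_apply, O, mul_left_comm]

lemma sumPd_smul (c : ℚ) (A : ℕ+ → Module.End ℚ Poly) :
    (sumPd fun n => c • A n) = c • sumPd A := by
  refine LinearMap.ext fun F => ?_
  simp only [LinearMap.smul_apply]
  rw [sumPd_apply_of_subset _ _ subset_rfl, sumPd_apply_of_subset _ _ subset_rfl, Finset.smul_sum]
  rfl

/-- The outermost derivative contributes once and the inner ones, by induction, $i$ times the same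
operator; whence the factor $i+1$. -/
lemma commutator_O_succ_mulX (i m : ℕ) (k : ℕ+) :
    commutator (O (i + 1) m) (mulX k) = ((i + 1 : ℚ) / (k : ℕ).factorial) • O i (m + k) := by
  induction i generalizing m with
  | zero =>
    rw [O_succ, commutator_sumPd_mulX]
    simp only [commutator_smul_left, commutator_O_zero_mulX, smul_zero]
    have : (sumPd fun n => 0) = 0 := by
      simpa using sumPd_smul 0 (fun _ => 0)
    rw [this]; simp
  | succ i ih =>
    rw [O_succ, commutator_sumPd_mulX]
    simp only [commutator_smul_left, ih]
    have : (fun n : ℕ+ => (1 / (n : ℕ).factorial : ℚ) • ((i + 1 : ℚ) / (k : ℕ).factorial) •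
        O i (m + n + k)) = fun n : ℕ+ => ((i + 1 : ℚ) / (k : ℕ).factorial) •
          ((1 / (n : ℕ).factorial : ℚ) • O i ((m + k) + n)) := by
      funext n
      rw [smul_comm, add_right_comm]
    rw [this, sumPd_smul]
    change _ + _ • O (i + 1) (m + k) = _
    rw [← add_smul]
    congr 1
    push_cast; ring

lemma commutator_O_mulX (i m : ℕ) (k : ℕ+) :
    commutator (O i m) (mulX k) = ((i : ℚ) / (k : ℕ).factorial) • O (i - 1) (m + k) := by
  cases i with
  | zero => simp [commutator_O_zero_mulX]
  | succ i => rw [commutator_O_succ_mulX]; simp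

lemma end_ext {A B : Module.End ℚ Poly} (h1 : A 1 = B 1)
    (hX : ∀ k, commutator A (mulX k) = commutator B (mulX k)) : A = B := by
  rw [← sub_eq_zero]
  refine end_eq_zero (by simp [h1]) fun k => ?_
  rw [commutator_sub_left, hX, sub_self]

lemma commutator_O_zero_O {m j l : ℕ} (hm : 2 ≤ m) :
    commutator (O 0 m) (O j l) = (-(j * m : ℚ)) • O (j - 1) (m + l - 1) := by
  obtain ⟨k, rfl⟩ : ∃ k : ℕ+, m = k + 1 :=
    ⟨⟨m - 1, by omega⟩, by rw [PNat.mk_coe]; omega⟩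
  have hk := k.pos
  rw [O_zero_succ, commutator_smul_left, commutator_swap, commutator_O_mulX, smul_smul,
    smul_smul, show (k : ℕ) + 1 + l - 1 = l + k by omega]
  congr 1
  rw [Nat.factorial_succ]
  push_cast
  field_simp

/-- This is the Poisson bracket of $t^m\varphi^i$ and $t^l\varphi^j$. By the Jacobi identity, the
commutator with $x_k$ reduces the claim to smaller $i+j$. The lower bounds keep all variable indices
positive: `O 0 0` and `O 0 1` involve the junk value `x 0`. -/
lemma commutator_O_O (i j : ℕ) : ∀ {m l : ℕ}, 2 ≤ i + m → 2 ≤ j + l →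
    commutator (O i m) (O j l) = ((i * l - j * m : ℚ)) • O (i + j - 1) (m + l - 1) := by
  induction hN : i + j using Nat.strong_induction_on generalizing i j with
  | _ N ih =>
  intro m l him hjl
  subst hN
  rcases Nat.eq_zero_or_pos i with rfl | hi
  · rw [commutator_O_zero_O (by omega)]; simp
  rcases Nat.eq_zero_or_pos j with rfl | hj
  · rw [commutator_swap, commutator_O_zero_O (by omega), smul_smul, add_comm l m]
    simp
  refine end_ext ?_ fun k => ?_
  · obtain ⟨i, rfl⟩ : ∃ i', i = i' + 1 := ⟨i - 1, by omega⟩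
    obtain ⟨j, rfl⟩ : ∃ i', j = i' + 1 := ⟨j - 1, by omega⟩
    simp [commutator, O_succ_one, show i + 1 + (j + 1) - 1 = (i + j) + 1 by omega]
  · have hk := k.pos
    rw [commutator_commutator, commutator_O_mulX, commutator_O_mulX, commutator_smul_left,
      commutator_smul_right, commutator_smul_left,
      ih (i - 1 + j) (by omega) (i - 1) j rfl (by omega) (by omega),
      ih (i + (j - 1)) (by omega) i (j - 1) rfl (by omega) (by omega), commutator_O_mulX]
    rw [show i - 1 + j - 1 = i + j - 1 - 1 by omega, show i + (j - 1) - 1 = i + j - 1 - 1 by omega,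
      show m + k + l - 1 = m + (l + k) - 1 by omega, smul_smul, smul_smul, smul_smul, ← add_smul]
    -- The subtraction in `m + l - 1` truncates when both are zero, but there the coefficient
    -- vanishes.
    by_cases h0 : m + l = 0
    · obtain ⟨rfl, rfl⟩ : m = 0 ∧ l = 0 := by omega
      trans (0 : ℚ) • O (i + j - 1 - 1) (0 + (0 + k) - 1)
      · congr 1; push_cast; ring
      · simp
    · rw [show m + l - 1 + k = m + (l + k) - 1 by omega]
      congr 1
      push_cast [show 1 ≤ i by omega, show 1 ≤ j by omega, show 1 ≤ i + j by omega]
      ring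

/-! ### `D` and `hOp` in terms of the family, and their commutation relations -/

lemma commutator_pd_mulX (n k : ℕ+) :
    commutator (pd n : Module.End ℚ Poly) (mulX k) = if n = k then 1 else 0 := by
  refine LinearMap.ext fun F => ?_
  simp only [commutator, LinearMap.sub_apply, Module.End.mul_apply, mulX_apply, pd_X_mul]
  split_ifs <;> simp

lemma pd_mulLeft_x (n : ℕ+) (k : ℕ) (hk : k ≠ n) (h : 0 < k) :
    commutator (pd n : Module.End ℚ Poly) (LinearMap.mulLeft ℚ (x k)) = 0 := by
  rw [x_of_pos h]
  have := commutator_pd_mulX n ⟨k, h⟩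
  rw [if_neg (fun h => hk (by rw [h]; rfl))] at this
  exact this

/-- The coefficients of `O i m` are multiples of $x_r$ with $r\ge i+m-1\ge 2$, so $\partial_1$ does
not see them. -/
lemma commutator_pd_O (i : ℕ) : ∀ {m : ℕ}, 3 ≤ i + m →
    commutator (pd 1 : Module.End ℚ Poly) (O i m) = 0 := by
  induction i with
  | zero =>
    intro m hm
    rw [O, commutator_smul_right, pd_mulLeft_x _ _ (by simp; omega) (by omega), smul_zero]
  | succ i ih =>
    intro m hm
    refine end_eq_zero (by simp [commutator, O_succ_one, pd_one]) fun k => ?_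
    have hk := k.pos
    rw [commutator_commutator, commutator_O_mulX, commutator_smul_right]
    simp only [Nat.add_sub_cancel]
    rw [ih (by omega), commutator_pd_mulX]
    split_ifs <;> simp [commutator_zero_left, commutator_one_left]

lemma commutator_pd_O_one_one :
    commutator (pd 1 : Module.End ℚ Poly) (O 1 1) = (2 : ℚ) • (pd 1 : Module.End ℚ Poly) := by
  refine end_ext (by simp [commutator, O_succ_one, pd_one]) fun k => ?_
  have hk := k.pos
  rw [commutator_commutator, commutator_O_mulX, commutator_smul_right, commutator_smul_left]
  simp only [Nat.sub_self]
  rw [add_comm 1, O_zero_succ, commutator_smul_right, commutator_pd_mulX]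
  split_ifs with h
  · subst h
    simp [commutator_one_left]
  · simp [commutator_zero_left]

lemma hOp_eq (g : ℕ) : hOp g = -(g : ℚ) • 1 + O 1 1 := by
  unfold hOp
  congr 1
  refine LinearMap.ext fun F => ?_
  change ∑ᶠ n : ℕ+, _ = ∑ᶠ n : ℕ+, _
  refine finsum_congr fun n => ?_
  change ((n : ℚ) + 1) • x n * _ = ((1 / (n : ℕ).factorial : ℚ) • O 0 (1 + n)) (pd n F)
  rw [add_comm 1, O_zero_succ, smul_smul, LinearMap.smul_apply, mulX_apply, x_pnat, smul_mul_assoc,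
    Nat.factorial_succ]
  congr 1
  push_cast
  field_simp

lemma O_two_zero_apply (F : Poly) : O 2 0 F =
    diffOp₂ (fun p => (Nat.choose (p.1 + p.2) p.1 : ℚ) • x ((p.1 : ℕ) + p.2 - 1)) F := by
  change _ = ∑ᶠ p : ℕ+ × ℕ+, _
  rw [finsum_eq_sum_of_support_subset (s := F.vars ×ˢ F.vars), Finset.sum_product_right, O_succ,
    sumPd_apply_of_subset _ _ subset_rfl]
  · refine Finset.sum_congr rfl fun n _ => ?_
    rw [O_succ, LinearMap.smul_apply,
      sumPd_apply_of_forall (s := F.vars) _ _ (fun i hi => by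
        rw [pd_comm, pd_eq_zero hi, map_zero]), Finset.smul_sum]
    refine Finset.sum_congr rfl fun m _ => ?_
    simp only [O, LinearMap.smul_apply, LinearMap.mulLeft_apply, smul_smul, smul_mul_assoc]
    rw [show 0 + (n : ℕ) + m - 1 = m + n - 1 by omega]
    congr 1
    rw [Nat.cast_add_choose, zero_add, add_comm (n : ℕ)]
    field_simp
  · intro p hp
    by_contra h
    apply hp
    rw [Finset.mem_coe, Finset.mem_product, not_and_or] at h
    rcases h with h | h
    · simp only [pd_comm p.1, pd_eq_zero h, map_zero, mul_zero]
    · simp only [pd_eq_zero h, map_zero, mul_zero]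

lemma D_eq (g : ℕ) : D g = -(g : ℚ) • (pd 1 : Module.End ℚ Poly) + (1 / 2 : ℚ) • O 2 0 := by
  unfold D
  congr 2
  exact LinearMap.ext fun F => (O_two_zero_apply F).symm

lemma apply_of_commutator {A B C : Module.End ℚ Poly} (h : commutator A B = C) (F : Poly) :
    A (B F) = B (A F) + C F := by
  rw [← h]; simp [commutator]

lemma commutator_D (g : ℕ) (A : Module.End ℚ Poly) : commutator (D g) A =
    -(g : ℚ) • commutator (pd 1 : Module.End ℚ Poly) A + (1 / 2 : ℚ) • commutator (O 2 0) A := by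
  rw [D_eq, commutator_add_left, commutator_smul_left, commutator_smul_left]

lemma commutator_hOp (g : ℕ) (A : Module.End ℚ Poly) :
    commutator (hOp g) A = commutator (O 1 1) A := by
  rw [hOp_eq, commutator_add_left, commutator_smul_left, commutator_one_left, smul_zero, zero_add]

lemma D_x_one_mul (g : ℕ) (F : Poly) : D g (x 1 * F) = x 1 * D g F + hOp g F := by
  have : commutator (D g) (mulX 1) = hOp g := by
    rw [commutator_D, commutator_O_mulX, commutator_pd_mulX, hOp_eq, smul_smul]
    simp
  exact apply_of_commutator this F

lemma D_X_mul (g : ℕ) {k : ℕ+} (hk : 2 ≤ (k : ℕ)) (F : Poly) :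
    D g (X k * F) = X k * D g F + (1 / (k : ℕ).factorial : ℚ) • O 1 k F := by
  have : commutator (D g) (mulX k) = (1 / (k : ℕ).factorial : ℚ) • O 1 k := by
    rw [commutator_D, commutator_O_mulX, commutator_pd_mulX, if_neg, smul_zero, zero_add, smul_smul,
      zero_add]
    · congr 1; push_cast; ring
    · rintro rfl; simp at hk
  exact apply_of_commutator this F

lemma hOp_D (g : ℕ) (F : Poly) : hOp g (D g F) = D g (hOp g F) - (2 : ℚ) • D g F := by
  have : commutator (hOp g) (D g) = (-2 : ℚ) • D g := by
    rw [commutator_hOp, commutator_swap, commutator_D, commutator_pd_O_one_one,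
      commutator_O_O 2 1 (by norm_num) (by norm_num), D_eq]
    simp only [smul_add, smul_smul]
    congr 2 <;> ring
  rw [apply_of_commutator this F]
  simp [sub_eq_add_neg]

lemma hOp_X_mul (g : ℕ) (k : ℕ+) (F : Poly) :
    hOp g (X k * F) = X k * hOp g F + ((k : ℚ) + 1) • (X k * F) := by
  have : commutator (hOp g) (mulX k) = ((k : ℚ) + 1) • mulX k := by
    rw [commutator_hOp, commutator_O_mulX, Nat.sub_self, add_comm 1, O_zero_succ, smul_smul]
    congr 1
    rw [Nat.factorial_succ]
    push_cast
    field_simp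
  exact apply_of_commutator this F

lemma hOp_x_mul (g : ℕ) {k : ℕ} (hk : 0 < k) (F : Poly) :
    hOp g (x k * F) = x k * hOp g F + ((k : ℚ) + 1) • (x k * F) := by
  rw [x_of_pos hk]; exact hOp_X_mul g ⟨k, hk⟩ F

lemma hOp_one (g : ℕ) : hOp g 1 = -(g : ℚ) • 1 := by
  rw [hOp_eq]; simp [O_succ_one]

lemma D_one (g : ℕ) : D g 1 = 0 := by
  rw [D_eq]; simp [O_succ_one, pd_one]

/-- Bracketing with $D$ trades a $t$ for a $\varphi$, so it can be repeated only $l$ times before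
giving zero. The $\partial_1$ part of $D$ drops out by `commutator_pd_O`. -/
lemma D_O (g : ℕ) {j l : ℕ} (h : 3 ≤ j + l) (F : Poly) :
    D g (O j l F) = O j l (D g F) + (l : ℚ) • O (j + 1) (l - 1) F := by
  have : commutator (D g) (O j l) = (l : ℚ) • O (j + 1) (l - 1) := by
    rw [commutator_D, commutator_pd_O _ h, commutator_O_O 2 j (by norm_num) (by omega), smul_zero,
      zero_add, smul_smul, show 2 + j - 1 = j + 1 by omega, zero_add]
    congr 1
    push_cast; ring
  exact apply_of_commutator this F

/-! ### Divided powers of $x_1$ and truncated exponential sums -/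

lemma x₁div_natCast (n : ℕ) : x₁div n = (1 / (n.factorial : ℚ)) • x 1 ^ n := by
  simp [x₁div]

lemma x₁div_of_neg {a : ℤ} (h : a < 0) : x₁div a = 0 := by
  simp [x₁div, not_le.mpr h]

lemma x₁div_zero : x₁div 0 = 1 := by simpa using x₁div_natCast 0

lemma x_one_mul_x₁div (a : ℤ) : x 1 * x₁div a = ((a : ℚ) + 1) • x₁div (a + 1) := by
  rcases lt_or_ge a 0 with h | h
  · rw [x₁div_of_neg h, mul_zero]
    rcases eq_or_ne a (-1) with rfl | h'
    · simp
    · rw [x₁div_of_neg (by omega), smul_zero]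
  · lift a to ℕ using h
    have := x₁div_natCast (a + 1)
    push_cast at this ⊢
    rw [this, x₁div_natCast, mul_smul_comm, smul_smul, pow_succ', Nat.factorial_succ]
    congr 1
    push_cast
    field_simp

lemma hOp_x₁div_mul (g : ℕ) {c : ℤ} {w : Poly} (hw : hOp g w = -(c : ℚ) • w) (a : ℤ) :
    hOp g (x₁div a * w) = (2 * a - c : ℚ) • (x₁div a * w) := by
  rcases lt_or_ge a 0 with h | h
  · simp [x₁div_of_neg h]
  lift a to ℕ using h
  rw [x₁div_natCast, smul_mul_assoc, map_smul, smul_comm]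
  congr 1
  induction a with
  | zero => simp [hw]
  | succ n ih =>
    rw [pow_succ', mul_assoc, hOp_x_mul g one_pos, ih, mul_smul_comm, ← add_smul]
    congr 1
    push_cast; ring

/-- Moving $D$ past each factor $x_1$ costs one $h$, which acts on $x_1^iw$ by the scalar $2i-c$;
the scalars add up to $a(a-1-c)$. -/
lemma D_x₁div_mul (g : ℕ) {c : ℤ} {w : Poly} (hw : hOp g w = -(c : ℚ) • w) (a : ℤ) :
    D g (x₁div a * w) = (a - 1 - c : ℚ) • (x₁div (a - 1) * w) + x₁div a * D g w := by
  rcases lt_or_ge a 0 with h | h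
  · simp [x₁div_of_neg h, x₁div_of_neg (show a - 1 < 0 by omega)]
  lift a to ℕ using h
  induction a with
  | zero => simp [x₁div_zero, x₁div_of_neg]
  | succ n ih =>
    have h0 : ((n : ℚ) + 1) ≠ 0 := by positivity
    have h1 := x_one_mul_x₁div n
    have h2 := x_one_mul_x₁div (n - 1)
    simp only [Int.cast_natCast, Int.cast_sub, Int.cast_one, sub_add_cancel] at h1 h2
    refine smul_right_injective _ h0 ?_
    simp only
    push_cast
    rw [← map_smul, ← smul_mul_assoc, ← h1, mul_assoc, D_x_one_mul, ih, hOp_x₁div_mul g hw, mul_add,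
      mul_smul_comm, ← mul_assoc, h2, ← mul_assoc, h1, add_sub_cancel_right]
    simp only [smul_add, smul_smul, smul_mul_assoc]
    rw [add_right_comm, ← add_smul]
    congr 2
    · push_cast
      ring
    · rw [add_sub_cancel_right]

lemma hOp_D_of_eigen (g : ℕ) {c : ℤ} {w : Poly} (hw : hOp g w = -(c : ℚ) • w) :
    hOp g (D g w) = -((c + 2 : ℤ) : ℚ) • D g w := by
  rw [hOp_D, hw, map_smul, ← sub_smul]
  congr 1
  push_cast; ring

lemma hOp_D_pow_of_eigen (g : ℕ) {c : ℤ} {w : Poly} (hw : hOp g w = -(c : ℚ) • w) (j : ℕ) :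
    hOp g ((D g ^ j) w) = -((c + 2 * j : ℤ) : ℚ) • (D g ^ j) w := by
  induction j with
  | zero => simp [hw]
  | succ j ih =>
    rw [pow_succ', Module.End.mul_apply, hOp_D_of_eigen g ih]
    congr 2
    push_cast; ring

/-- The truncated exponential sum `∑_{j < N} x₁^{[e+j]} D^j(w) / j!`. -/
def expSum (g N : ℕ) (e : ℤ) : Module.End ℚ Poly :=
  ∑ j ∈ Finset.range N, (1 / (j.factorial : ℚ)) • (LinearMap.mulLeft ℚ (x₁div (e + j)) ∘ₗ D g ^ j)

lemma expSum_apply (g N : ℕ) (e : ℤ) (w : Poly) : expSum g N e w =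
    ∑ j ∈ Finset.range N, (1 / (j.factorial : ℚ)) • (x₁div (e + j) * (D g ^ j) w) := by
  simp [expSum]

/-- The $j$-th term contributes $e+j-1-(c+2j)$ by `D_x₁div_mul`, and the shifted $D^{j+1}$ terms add
$j$, so the factor no longer depends on $j$. The boundary term of the shift vanishes because
$D^Nw=0$. -/
lemma D_expSum (g : ℕ) {N : ℕ} {c : ℤ} {w : Poly} (hw : hOp g w = -(c : ℚ) • w)
    (hN : (D g ^ N) w = 0) (e : ℤ) :
    D g (expSum g N e w) = (e - 1 - c : ℚ) • expSum g N (e - 1) w := by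
  simp only [expSum_apply, map_sum, map_smul]
  simp only [D_x₁div_mul g (hOp_D_pow_of_eigen g hw _), smul_add, Finset.sum_add_distrib]
  have key : ∑ j ∈ Finset.range N, (1 / (j.factorial : ℚ)) • (x₁div (e + j) * D g ((D g ^ j) w)) =
      ∑ j ∈ Finset.range N,
        ((j : ℚ) / (j.factorial : ℚ)) • (x₁div (e - 1 + j) * (D g ^ j) w) := by
    have h1 := Finset.sum_range_succ
      (fun j : ℕ => ((j : ℚ) / (j.factorial : ℚ)) • (x₁div (e - 1 + j) * (D g ^ j) w)) N
    rw [hN, mul_zero, smul_zero, add_zero, Finset.sum_range_succ'] at h1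
    simp only [Nat.cast_zero, zero_div, zero_smul, add_zero] at h1
    rw [← h1]
    refine Finset.sum_congr rfl fun j _ => ?_
    rw [pow_succ', Module.End.mul_apply, Nat.factorial_succ]
    congr 1
    · push_cast; field_simp
    · congr 2; push_cast; ring
  rw [key, ← Finset.sum_add_distrib, Finset.smul_sum]
  refine Finset.sum_congr rfl fun j _ => ?_
  rw [smul_smul, smul_smul, show e + j - 1 = e - 1 + j by ring, ← add_smul]
  congr 1
  push_cast; ring

/-! ### The intersection of the images of powers of $D$ is an ideal -/

/-- The intersection of the images of all powers of `D`. -/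
def imD (g : ℕ) : Submodule ℚ Poly := ⨅ (n : ℕ) (_ : 1 ≤ n), LinearMap.range (D g ^ n)

lemma mem_imD {g : ℕ} {F : Poly} : F ∈ imD g ↔ ∀ n : ℕ, F ∈ LinearMap.range (D g ^ n) := by
  simp only [imD, Submodule.mem_iInf]
  refine ⟨fun h n => ?_, fun h n _ => h n⟩
  rcases Nat.eq_zero_or_pos n with rfl | hn
  · exact ⟨F, by simp⟩
  · exact h n hn

lemma D_mem_range {g n : ℕ} {F : Poly} (h : F ∈ LinearMap.range (D g ^ n)) :
    D g F ∈ LinearMap.range (D g ^ (n + 1)) := by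
  obtain ⟨G, rfl⟩ := h
  exact ⟨G, by rw [pow_succ', Module.End.mul_apply]⟩

lemma range_mono {g m n : ℕ} (h : m ≤ n) {F : Poly} (hF : F ∈ LinearMap.range (D g ^ n)) :
    F ∈ LinearMap.range (D g ^ m) := by
  obtain ⟨G, rfl⟩ := hF
  obtain ⟨k, rfl⟩ := Nat.exists_eq_add_of_le h
  exact ⟨(D g ^ k) G, by rw [pow_add, Module.End.mul_apply]⟩

lemma D_mem_imD {g : ℕ} {F : Poly} (h : F ∈ imD g) : D g F ∈ imD g := by
  rw [mem_imD] at h ⊢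
  exact fun n => range_mono (Nat.le_succ n) (D_mem_range (h n))

lemma hOp_mem_range {g n : ℕ} {F : Poly} (h : F ∈ LinearMap.range (D g ^ n)) :
    hOp g F ∈ LinearMap.range (D g ^ n) := by
  induction n generalizing F with
  | zero => exact ⟨hOp g F, by simp⟩
  | succ n ih =>
    obtain ⟨G, rfl⟩ := h
    have h1 : (D g ^ (n + 1)) G = D g ((D g ^ n) G) := by rw [pow_succ', Module.End.mul_apply]
    have h2 := ih (LinearMap.mem_range_self _ G)
    rw [h1, hOp_D]
    exact sub_mem (D_mem_range h2)
      (Submodule.smul_mem _ _ (D_mem_range (LinearMap.mem_range_self _ G)))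

lemma hOp_mem_imD {g : ℕ} {F : Poly} (h : F ∈ imD g) : hOp g F ∈ imD g := by
  rw [mem_imD] at h ⊢
  exact fun n => hOp_mem_range (h n)

lemma x_one_mul_mem_range {g : ℕ} (n : ℕ) {F : Poly} (h : F ∈ LinearMap.range (D g ^ (n + 1))) :
    x 1 * F ∈ LinearMap.range (D g ^ n) := by
  induction n generalizing F with
  | zero => exact ⟨x 1 * F, by simp⟩
  | succ n ih =>
    obtain ⟨G, rfl⟩ := h
    have h1 : (D g ^ (n + 1 + 1)) G = D g ((D g ^ (n + 1)) G) := by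
      rw [pow_succ', Module.End.mul_apply]
    have h2 : x 1 * (D g ^ (n + 1 + 1)) G =
        D g (x 1 * (D g ^ (n + 1)) G) - hOp g ((D g ^ (n + 1)) G) := by
      rw [D_x_one_mul, h1]; ring
    rw [h2]
    exact sub_mem (D_mem_range (ih (LinearMap.mem_range_self _ G)))
      (hOp_mem_range (LinearMap.mem_range_self _ G))

/-- By `D_O`, pulling one $D$ out to the left leaves an error term with `l` lowered by one. At `l =
0` the operator commutes with $D$, so only `l` powers are lost in total. -/
lemma O_D_pow_mem_range (g : ℕ) (l : ℕ) : ∀ (N M j : ℕ), 3 ≤ j + l → N + l ≤ M → ∀ F,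
    O j l ((D g ^ M) F) ∈ LinearMap.range (D g ^ N) := by
  induction l with
  | zero =>
    intro N M j hj hM F
    refine range_mono (show N ≤ M by omega) ⟨O j 0 F, ?_⟩
    clear hM
    induction M generalizing F with
    | zero => simp
    | succ M ih =>
      rw [pow_succ, Module.End.mul_apply, D_O g hj, Module.End.mul_apply]
      simp [ih]
  | succ l ihl =>
    intro N
    induction N with
    | zero => intro M j _ _ F; exact ⟨_, by rw [pow_zero, Module.End.one_apply]⟩
    | succ N ihN =>
      intro M j hj hM F
      obtain ⟨M, rfl⟩ : ∃ M', M = M' + 1 := ⟨M - 1, by omega⟩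
      have h := D_O g hj ((D g ^ M) F)
      have h2 : O j (l + 1) ((D g ^ (M + 1)) F) =
          D g (O j (l + 1) ((D g ^ M) F)) - ((l + 1 : ℕ) : ℚ) • O (j + 1) l ((D g ^ M) F) := by
        rw [h, pow_succ', Module.End.mul_apply]; simp
      rw [h2]
      exact sub_mem (D_mem_range (ihN M j hj (by omega) F))
        (Submodule.smul_mem _ _ (ihl (N + 1) M (j + 1) (by omega) (by omega) F))

lemma X_mul_mem_imD {g : ℕ} (k : ℕ+) {F : Poly} (h : F ∈ imD g) : X k * F ∈ imD g := by
  rw [mem_imD] at h ⊢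
  intro n
  rcases eq_or_ne k 1 with rfl | hk
  · have := x_one_mul_mem_range n (h (n + 1))
    rwa [show x 1 = X (1 : ℕ+) from x_pnat 1] at this
  · have hk2 : 2 ≤ (k : ℕ) := by
      have := k.pos
      have : (k : ℕ) ≠ 1 := fun h => hk (PNat.coe_injective h)
      omega
    -- Multiplication by $x_k$ is a multiple of `O 0 (k + 1)`, which loses $k+1$ powers of $D$.
    obtain ⟨G, rfl⟩ := h (n + (k + 1))
    have := O_D_pow_mem_range g (k + 1) n (n + (k + 1)) 0 (by omega) le_rfl G
    rw [O_zero_succ, LinearMap.smul_apply, mulX_apply] at this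
    exact (Submodule.smul_mem_iff _ (by positivity)).mp this

lemma mul_mem_imD {g : ℕ} (P : Poly) {F : Poly} (h : F ∈ imD g) : P * F ∈ imD g := by
  induction P using MvPolynomial.induction_on with
  | C a => rw [← smul_eq_C_mul]; exact Submodule.smul_mem _ _ h
  | add P Q hP hQ => rw [add_mul]; exact add_mem hP hQ
  | mul_X P k hP => rw [mul_comm P, mul_assoc]; exact X_mul_mem_imD k hP

/-- The sums with exponents $c+1,c+2,\dots$ form an infinite chain in which $D$ sends each to a
nonzero multiple of its predecessor, so the first is divisible by every power of $D$. -/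
lemma expSum_mem_imD (g : ℕ) {N : ℕ} {c : ℤ} {w : Poly} (hw : hOp g w = -(c : ℚ) • w)
    (hN : (D g ^ N) w = 0) : expSum g N (c + 1) w ∈ imD g := by
  rw [mem_imD]
  have key : ∀ n i : ℕ, expSum g N (c + 1 + i) w ∈ LinearMap.range (D g ^ n) := by
    intro n
    induction n with
    | zero => intro i; exact ⟨_, by rw [pow_zero, Module.End.one_apply]⟩
    | succ n ih =>
      intro i
      have h1 := D_mem_range (ih (i + 1))
      rw [D_expSum g hw hN, show c + 1 + ((i + 1 : ℕ) : ℤ) - 1 = c + 1 + i by push_cast; ring] at h1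
      refine (Submodule.smul_mem_iff _ ?_).mp h1
      push_cast
      rw [show (c : ℚ) + 1 + (i + 1) - 1 - c = i + 1 by ring]
      positivity
  intro n
  simpa using key n 0

/-- Solve $D(x_1^{[a+1]}w)=(a-c)x_1^{[a]}w+x_1^{[a+1]}Dw$ for the middle term. Passing to
$x_1^{[a+1]}Dw$ lowers both $N$ and $a-c$ by one, as $c$ becomes $c+2$; so the inequality persists
and $a-c>0$ whenever it is divided by. -/
lemma x₁div_mul_mem_range (g n : ℕ) : ∀ (N : ℕ) {a c : ℤ} {w : Poly},
    hOp g w = -(c : ℚ) • w → (D g ^ N) w = 0 → N ≤ a - c →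
    x₁div a * w ∈ LinearMap.range (D g ^ n) := by
  induction n with
  | zero => intro N a c w _ _ _; exact ⟨_, by rw [pow_zero, Module.End.one_apply]⟩
  | succ n ihn =>
    intro N
    induction N with
    | zero =>
      intro a c w _ h _
      have : w = 0 := by simpa using h
      simp [this]
    | succ N ihN =>
      intro a c w hw h hac
      have h1 := D_x₁div_mul g hw (a + 1)
      have h2 := D_mem_range (ihn (N + 1) (a := a + 1) hw h (by omega))
      have h3 := ihN (a := a + 1) (hOp_D_of_eigen g hw) (by
        rwa [pow_succ, Module.End.mul_apply] at h) (by push_cast at hac; omega)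
      have h4 : x₁div a * w ∈ LinearMap.range (D g ^ (n + 1)) := by
        have h5 := sub_mem h2 h3
        rw [h1, add_sub_cancel_right, add_sub_cancel_right] at h5
        refine (Submodule.smul_mem_iff _ ?_).mp h5
        have : (0 : ℚ) < ((a - c : ℤ) : ℚ) := by
          push_cast at hac
          exact_mod_cast (show (0 : ℤ) < a - c by omega)
        push_cast at this ⊢
        rw [add_sub_cancel_right]
        exact this.ne'
      exact h4

/-! ### The action of $D$ on products of variables other than $x_1$ -/

section Products

variable {ι : Type*} [DecidableEq ι]

lemma hOp_prod (g : ℕ) {ν : ι → ℕ} {s : Finset ι} (hν : ∀ i ∈ s, 0 < ν i) :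
    hOp g (∏ i ∈ s, x (ν i)) =
      -((g - ∑ i ∈ s, ν i - s.card : ℤ) : ℚ) • ∏ i ∈ s, x (ν i) := by
  induction s using Finset.induction_on with
  | empty => simpa using hOp_one g
  | insert a s ha ih =>
    rw [Finset.prod_insert ha, hOp_x_mul g (hν a (by simp)), ih fun i hi => hν i (by simp [hi]),
      mul_smul_comm, ← add_smul, Finset.sum_insert ha, Finset.card_insert_of_notMem ha]
    congr 1
    push_cast; ring

/-- The sequence obtained by replacing `ν_i` with `ν_i + ν_j - 1`. -/
def merge (ν : ι → ℕ) (i j : ι) : ι → ℕ := Function.update ν i (ν i + ν j - 1)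

lemma merge_self (ν : ι → ℕ) (i j : ι) : merge ν i j i = ν i + ν j - 1 := by simp [merge]

lemma merge_of_ne (ν : ι → ℕ) {i j k : ι} (h : k ≠ i) : merge ν i j k = ν k := by simp [merge, h]

lemma one_lt_merge {ν : ι → ℕ} {s : Finset ι} (hν : ∀ i ∈ s, 1 < ν i) {i j : ι} (hi : i ∈ s)
    (hj : j ∈ s) : ∀ k ∈ s.erase j, 1 < merge ν i j k := by
  intro k hk
  rcases eq_or_ne k i with rfl | h
  · rw [merge_self]
    have := hν k hi
    have := hν j hj
    omega
  · rw [merge_of_ne ν h]; exact hν k (Finset.mem_of_mem_erase hk)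

lemma sum_merge {ν : ι → ℕ} {s : Finset ι} {i j : ι} (hi : i ∈ s) (hj : j ∈ s) (hij : i ≠ j)
    (h : 0 < ν i) : ∑ k ∈ s.erase j, merge ν i j k + 1 = ∑ k ∈ s, ν k := by
  have hi' : i ∈ s.erase j := Finset.mem_erase.mpr ⟨hij, hi⟩
  rw [← Finset.add_sum_erase _ _ hj, ← Finset.add_sum_erase _ _ hi', ← Finset.add_sum_erase _ _ hi',
    merge_self, Finset.sum_congr rfl fun k hk => merge_of_ne ν (Finset.ne_of_mem_erase hk)]
  omega

lemma O_one_prod (k : ℕ) {ν : ι → ℕ} {s : Finset ι} (hν : ∀ i ∈ s, 0 < ν i) :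
    O 1 k (∏ i ∈ s, x (ν i)) = ∑ j ∈ s, (((k + ν j).factorial : ℚ) / (ν j).factorial) •
      (x (k + ν j - 1) * ∏ i ∈ s.erase j, x (ν i)) := by
  induction s using Finset.induction_on with
  | empty => simp [O_succ_one]
  | insert a s ha ih =>
    have hc : ∀ F, O 1 k (x (ν a) * F) = x (ν a) * O 1 k F +
        (((k + ν a).factorial : ℚ) / (ν a).factorial) • (x (k + ν a - 1) * F) := by
      intro F
      have h := commutator_O_mulX 1 k ⟨ν a, hν a (by simp)⟩
      have h2 := apply_of_commutator h F
      rw [x_of_pos (hν a (by simp))]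
      refine h2.trans ?_
      congr 1
      simp only [Nat.sub_self, O, LinearMap.smul_apply, LinearMap.mulLeft_apply, smul_smul,
        PNat.mk_coe]
      congr 1
      push_cast; ring
    rw [Finset.prod_insert ha, hc, ih fun i hi => hν i (by simp [hi]), Finset.sum_insert ha,
      Finset.erase_insert ha, add_comm, Finset.mul_sum]
    congr 1
    refine Finset.sum_congr rfl fun j hj => ?_
    have : j ≠ a := fun h => ha (h ▸ hj)
    rw [Finset.erase_insert_of_ne this.symm, Finset.prod_insert (by simp [ha]), mul_smul_comm]
    congr 1; ring

lemma prod_merge {ν : ι → ℕ} {s : Finset ι} {i j : ι} (hi : i ∈ s) (hij : i ≠ j) :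
    ∏ k ∈ s.erase j, x (merge ν i j k) =
      x (ν i + ν j - 1) * ∏ k ∈ (s.erase j).erase i, x (ν k) := by
  rw [← Finset.mul_prod_erase _ _ (Finset.mem_erase.mpr ⟨hij, hi⟩), merge_self]
  congr 1
  exact Finset.prod_congr rfl fun k hk => by rw [merge_of_ne ν (Finset.ne_of_mem_erase hk)]

/-- The second order part merges pairs of factors; the halves account for ordered pairs, and
$\partial_1$ contributes nothing. -/
lemma D_prod (g : ℕ) {ν : ι → ℕ} {s : Finset ι} (hν : ∀ i ∈ s, 1 < ν i) :
    D g (∏ i ∈ s, x (ν i)) = ∑ i ∈ s, ∑ j ∈ s, if i = j then 0 else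
      ((ν i + ν j).choose (ν i) / 2 : ℚ) • ∏ k ∈ s.erase j, x (merge ν i j k) := by
  induction s using Finset.induction_on with
  | empty => simp [D_one]
  | insert a s ha ih =>
    have haν := hν a (by simp)
    have hsν : ∀ i ∈ s, 1 < ν i := fun i hi => hν i (by simp [hi])
    have hne : ∀ j ∈ s, a ≠ j := fun j hj h => ha (h ▸ hj)
    have h1 : D g (∏ i ∈ insert a s, x (ν i)) = x (ν a) * D g (∏ i ∈ s, x (ν i)) +
        (1 / (ν a).factorial : ℚ) • O 1 (ν a) (∏ i ∈ s, x (ν i)) := by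
      rw [Finset.prod_insert ha, x_of_pos (by omega : 0 < ν a)]
      exact D_X_mul g (k := ⟨ν a, by omega⟩) haν _
    rw [h1, ih hsν, O_one_prod _ fun i hi => (hsν i hi).trans' one_pos,
      Finset.sum_insert ha, Finset.sum_insert ha, if_pos rfl, zero_add]
    simp only [Finset.sum_insert ha, Finset.sum_add_distrib]
    rw [← add_assoc, add_comm]
    congr 1
    · rw [← Finset.sum_add_distrib, Finset.smul_sum]
      refine Finset.sum_congr rfl fun j hj => ?_
      have hj' := hne j hj
      rw [if_neg hj', if_neg hj'.symm, prod_merge (by simp) hj', prod_merge (by simp [hj]) hj'.symm,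
        Finset.erase_insert ha, Finset.erase_insert_of_ne hj', Finset.erase_insert (by simp [ha]),
        add_comm (ν j), ← add_smul, smul_smul]
      congr 1
      rw [Nat.cast_add_choose, add_comm (ν a), Nat.cast_add_choose]
      field_simp
      ring
    · rw [Finset.mul_sum]
      refine Finset.sum_congr rfl fun i hi => ?_
      rw [Finset.mul_sum]
      refine Finset.sum_congr rfl fun j hj => ?_
      split_ifs with hij
      · simp
      have hj' := hne j hj
      rw [prod_merge hi hij, prod_merge (by simp [hi]) hij, Finset.erase_insert_of_ne hj',
        Finset.erase_insert_of_ne (hne i hi), Finset.prod_insert (by simp [ha]), mul_smul_comm]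
      congr 1; ring

/-- Each $D$ merges two factors, and a single remaining variable is killed. This exponent, one
better than for the empty product, is what handles monomials of degree exactly $g$. -/
lemma D_pow_prod_eq_zero (g : ℕ) (N : ℕ) : ∀ {ν : ι → ℕ} {s : Finset ι}, (∀ i ∈ s, 1 < ν i) →
    s.Nonempty → s.card ≤ N → (D g ^ N) (∏ i ∈ s, x (ν i)) = 0 := by
  induction N with
  | zero => intro ν s _ hs h; simp at h; simp [h] at hs
  | succ N ih =>
    intro ν s hν hs h
    rw [pow_succ, Module.End.mul_apply, D_prod g hν, map_sum]
    refine Finset.sum_eq_zero fun i hi => ?_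
    rw [map_sum]
    refine Finset.sum_eq_zero fun j hj => ?_
    split_ifs with hij
    · simp
    rw [map_smul, ih (one_lt_merge hν hi hj) ⟨i, by simp [hij, hi]⟩, smul_zero]
    rw [Finset.card_erase_of_mem hj]; omega

lemma D_pow_prod_eq_zero' (g : ℕ) {N : ℕ} {ν : ι → ℕ} {s : Finset ι} (hν : ∀ i ∈ s, 1 < ν i)
    (h : s.card < N) : (D g ^ N) (∏ i ∈ s, x (ν i)) = 0 := by
  rcases s.eq_empty_or_nonempty with rfl | hs
  · obtain ⟨N, rfl⟩ : ∃ M, N = M + 1 := ⟨N - 1, by omega⟩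
    rw [pow_succ, Module.End.mul_apply]
    simp [D_one]
  · exact D_pow_prod_eq_zero g N hν hs h.le

end Products

/-! ### Set partitions with two elements in a common part -/

section Partitions

variable {ι : Type*} [DecidableEq ι] {s : Finset ι} {i j : ι}

/-- Adjoin `j` to a set containing `i`. -/
def adjoin (i j : ι) (J : Finset ι) : Finset ι := if i ∈ J then insert j J else J

lemma erase_adjoin {J : Finset ι} (hJ : j ∉ J) : (adjoin i j J).erase j = J := by
  unfold adjoin
  split_ifs with h
  · exact Finset.erase_insert hJ
  · exact Finset.erase_eq_of_notMem hJ

lemma adjoin_erase {J : Finset ι} (hij : i ≠ j) (h : i ∈ J ↔ j ∈ J) :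
    adjoin i j (J.erase j) = J := by
  unfold adjoin
  split_ifs with h'
  · exact Finset.insert_erase (h.mp (Finset.mem_of_mem_erase h'))
  · refine Finset.erase_eq_of_notMem fun hj => h' ?_
    exact Finset.mem_erase.mpr ⟨hij, h.mpr hj⟩

lemma mem_adjoin_of_ne {J : Finset ι} {k : ι} (hk : k ≠ j) : k ∈ adjoin i j J ↔ k ∈ J := by
  unfold adjoin
  split_ifs <;> simp [hk]

lemma self_mem_adjoin {J : Finset ι} (hJ : j ∉ J) : j ∈ adjoin i j J ↔ i ∈ J := by
  unfold adjoin
  split_ifs with h <;> simp [hJ, h]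

lemma notMem_of_mem_parts (P : Finpartition (s.erase j)) {J : Finset ι} (hJ : J ∈ P.parts) :
    j ∉ J := fun h => by simpa using P.subset hJ h

/-- The partition obtained by adjoining `j` to the part of `i`. -/
def adjoinPart (hi : i ∈ s) (hj : j ∈ s) (hij : i ≠ j) (P : Finpartition (s.erase j)) :
    Finpartition s :=
  Finpartition.ofExistsUnique (P.parts.image (adjoin i j))
    (by
      intro p hp k hk
      obtain ⟨J, hJ, rfl⟩ := Finset.mem_image.mp hp
      rcases eq_or_ne k j with rfl | hkj
      · exact hj
      · exact Finset.mem_of_mem_erase (P.subset hJ ((mem_adjoin_of_ne hkj).mp hk)))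
    (by
      intro k hk
      rcases eq_or_ne k j with rfl | hkj
      · obtain ⟨J, ⟨hJ, hiJ⟩, huniq⟩ := P.existsUnique_mem (Finset.mem_erase.mpr ⟨hij, hi⟩)
        refine ⟨adjoin i k J, ⟨Finset.mem_image_of_mem _ hJ,
          (self_mem_adjoin (notMem_of_mem_parts P hJ)).mpr hiJ⟩, ?_⟩
        rintro t ⟨ht, hkt⟩
        obtain ⟨J', hJ', rfl⟩ := Finset.mem_image.mp ht
        rw [huniq J' ⟨hJ', (self_mem_adjoin (notMem_of_mem_parts P hJ')).mp hkt⟩]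
      · obtain ⟨J, ⟨hJ, hiJ⟩, huniq⟩ := P.existsUnique_mem (Finset.mem_erase.mpr ⟨hkj, hk⟩)
        refine ⟨adjoin i j J, ⟨Finset.mem_image_of_mem _ hJ, (mem_adjoin_of_ne hkj).mpr hiJ⟩, ?_⟩
        rintro t ⟨ht, hkt⟩
        obtain ⟨J', hJ', rfl⟩ := Finset.mem_image.mp ht
        rw [huniq J' ⟨hJ', (mem_adjoin_of_ne hkj).mp hkt⟩])
    (by
      intro h
      obtain ⟨J, hJ, hJe⟩ := Finset.mem_image.mp h
      have := erase_adjoin (i := i) (notMem_of_mem_parts P hJ)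
      rw [hJe] at this
      exact P.ne_bot hJ (by rw [← this]; rfl))

lemma adjoinPart_parts (hi : i ∈ s) (hj : j ∈ s) (hij : i ≠ j) (P : Finpartition (s.erase j)) :
    (adjoinPart hi hj hij P).parts = P.parts.image (adjoin i j) := rfl

lemma adjoin_injOn (P : Finpartition (s.erase j)) : Set.InjOn (adjoin i j) (P.parts : Set _) := by
  intro J hJ J' hJ' h
  rw [← erase_adjoin (i := i) (notMem_of_mem_parts P hJ), h,
    erase_adjoin (notMem_of_mem_parts P hJ')]

lemma card_adjoinPart (hi : i ∈ s) (hj : j ∈ s) (hij : i ≠ j) (P : Finpartition (s.erase j)) :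
    (adjoinPart hi hj hij P).parts.card = P.parts.card := by
  rw [adjoinPart_parts, Finset.card_image_of_injOn (adjoin_injOn P)]

lemma part_adjoinPart (hi : i ∈ s) (hj : j ∈ s) (hij : i ≠ j) (P : Finpartition (s.erase j)) :
    (adjoinPart hi hj hij P).part i = insert j (P.part i) := by
  have hi' : i ∈ s.erase j := Finset.mem_erase.mpr ⟨hij, hi⟩
  have h1 : i ∈ P.part i := P.mem_part_self.mpr hi'
  have h2 : adjoin i j (P.part i) = insert j (P.part i) := if_pos h1
  rw [← h2]
  refine Finpartition.part_eq_of_mem _ ?_ ((mem_adjoin_of_ne hij).mpr h1)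
  exact Finset.mem_image_of_mem _ (P.part_mem.mpr hi')

lemma adjoinPart_injective (hi : i ∈ s) (hj : j ∈ s) (hij : i ≠ j) :
    Function.Injective (adjoinPart hi hj hij) := by
  intro P Q h
  have key : ∀ P : Finpartition (s.erase j),
      (adjoinPart hi hj hij P).parts.image (fun J => J.erase j) = P.parts := by
    intro P
    rw [adjoinPart_parts, Finset.image_image]
    conv_rhs => rw [← Finset.image_id (s := P.parts)]
    exact Finset.image_congr fun J hJ => erase_adjoin (notMem_of_mem_parts P hJ)
  exact Finpartition.ext (by rw [← key P, ← key Q, h])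

lemma exists_adjoinPart_eq (hi : i ∈ s) (hj : j ∈ s) (hij : i ≠ j) {P : Finpartition s}
    (h : j ∈ P.part i) : ∃ Q, adjoinPart hi hj hij Q = P := by
  have hiff : ∀ J ∈ P.parts, (i ∈ J ↔ j ∈ J) := by
    intro J hJ
    have hpi := P.part_mem.mpr hi
    refine ⟨fun hiJ => ?_, fun hjJ => ?_⟩
    · rwa [P.eq_of_mem_parts hJ hpi hiJ (P.mem_part_self.mpr hi)]
    · rw [P.eq_of_mem_parts hJ hpi hjJ h]
      exact P.mem_part_self.mpr hi
  refine ⟨(P.avoid {j}).copy (Finset.sdiff_singleton_eq_erase j s), Finpartition.ext ?_⟩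
  ext J
  rw [adjoinPart_parts, Finset.mem_image]
  change (∃ a ∈ (P.avoid {j}).parts, _) ↔ _
  simp only [Finpartition.mem_avoid, Finset.sdiff_singleton_eq_erase]
  constructor
  · rintro ⟨_, ⟨K, hK, _, rfl⟩, rfl⟩
    rwa [adjoin_erase hij (hiff K hK)]
  · intro hJ
    refine ⟨_, ⟨J, hJ, fun hle => ?_, rfl⟩, adjoin_erase hij (hiff J hJ)⟩
    obtain ⟨k, hk⟩ := P.nonempty_of_mem_parts hJ
    have hkj : k = j := by simpa using hle hk
    subst hkj
    exact hij (by simpa using hle ((hiff J hJ).mpr hk))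

end Partitions

/-! ### Divided powers of $D$ as sums over set partitions -/

variable {k : ℕ}

/-- The factor `b(J) x_{d(J)}` of a part `J`. -/
def partTerm (ν : Fin k → ℕ) (J : Finset (Fin k)) : Poly := b ν J • x (dIdx ν J)

/-- The sum of `b(J₁) ⋯ b(J_m) x_{d(J₁)} ⋯ x_{d(J_m)}` over the partitions of `s` into `m` parts. -/
def partitionSum (ν : Fin k → ℕ) (s : Finset (Fin k)) (m : ℕ) : Poly :=
  ∑ P : Finpartition s with P.parts.card = m, ∏ J ∈ P.parts, partTerm ν J

lemma partTerm_merge_of_notMem {ν : Fin k → ℕ} {i j : Fin k} {J : Finset (Fin k)} (hi : i ∉ J) :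
    partTerm (merge ν i j) J = partTerm ν J := by
  have h : ∀ l ∈ J, merge ν i j l = ν l := fun l hl =>
    merge_of_ne ν fun h => hi (h ▸ hl)
  unfold partTerm b dIdx
  rw [Finset.sum_congr rfl h, Finset.prod_congr rfl fun l hl => by rw [h l hl]]

/-- Merging lowers the sum of the indices and the size of the block by one each, so `dIdx` is
unchanged. The ratio of the factorials in `b`, times the binomial, is the stated fraction. -/
lemma partTerm_merge {ν : Fin k → ℕ} {i j : Fin k} {J : Finset (Fin k)} (hi : i ∈ J) (hj : j ∉ J)
    (hνi : 0 < ν i) (hνj : 0 < ν j) :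
    ((ν i + ν j).choose (ν i) : ℚ) • partTerm (merge ν i j) J =
      ((ν i + ν j : ℚ) / (∑ l ∈ insert j J, ν l : ℕ)) • partTerm ν (insert j J) := by
  have hij : i ≠ j := fun h => hj (h ▸ hi)
  have hsum := sum_merge (ν := ν) (s := insert j J) (by simp [hi]) (by simp) hij hνi
  rw [Finset.erase_insert hj] at hsum
  have hcard : (insert j J).card = J.card + 1 := Finset.card_insert_of_notMem hj
  have hd : dIdx (merge ν i j) J = dIdx ν (insert j J) := by
    unfold dIdx
    rw [hcard, ← hsum]; omega
  have hprod : (∏ l ∈ insert j J, ((ν l).factorial : ℚ)) * (ν i + ν j - 1).factorial =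
      (∏ l ∈ J, ((merge ν i j l).factorial : ℚ)) * ((ν i).factorial * (ν j).factorial) := by
    have h : ∏ l ∈ J.erase i, ((merge ν i j l).factorial : ℚ) =
        ∏ l ∈ J.erase i, ((ν l).factorial : ℚ) := Finset.prod_congr rfl fun l hl => by
      rw [merge_of_ne ν (Finset.ne_of_mem_erase hl)]
    rw [Finset.prod_insert hj, ← Finset.mul_prod_erase _ _ hi, ← Finset.mul_prod_erase _ _ hi,
      merge_self, h]
    ring
  unfold partTerm b
  rw [hd, smul_smul, smul_smul]
  congr 1
  rw [← hsum, Nat.factorial_succ, Nat.cast_add_choose]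
  obtain ⟨t, ht⟩ : ∃ t, ν i + ν j = t + 1 := ⟨ν i + ν j - 1, by omega⟩
  have htq : (ν i + ν j : ℚ) = t + 1 := by exact_mod_cast ht
  rw [ht, htq, Nat.factorial_succ]
  rw [ht, Nat.add_sub_cancel] at hprod
  have h1 : (∏ l ∈ insert j J, ((ν l).factorial : ℚ)) ≠ 0 :=
    Finset.prod_ne_zero_iff.mpr fun l _ => by positivity
  have h2 : (∏ l ∈ J, ((merge ν i j l).factorial : ℚ)) ≠ 0 :=
    Finset.prod_ne_zero_iff.mpr fun l _ => by positivity
  have h3 : ((∑ l ∈ J, merge ν i j l : ℕ) : ℚ) + 1 ≠ 0 := by positivity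
  push_cast at h3 ⊢
  field_simp
  linear_combination hprod

lemma choose_smul_prod_partTerm_merge {ν : Fin k → ℕ} {s : Finset (Fin k)} (hν : ∀ i ∈ s, 1 < ν i)
    {i j : Fin k} (hi : i ∈ s) (hj : j ∈ s) (hij : i ≠ j) (P : Finpartition (s.erase j)) :
    ((ν i + ν j).choose (ν i) / 2 : ℚ) • ∏ J ∈ P.parts, partTerm (merge ν i j) J =
      ((ν i + ν j : ℚ) / 2 / (∑ l ∈ (adjoinPart hi hj hij P).part i, ν l : ℕ)) •
        ∏ J ∈ (adjoinPart hi hj hij P).parts, partTerm ν J := by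
  have hi' : i ∈ s.erase j := Finset.mem_erase.mpr ⟨hij, hi⟩
  have hmem : P.part i ∈ P.parts := P.part_mem.mpr hi'
  have h1 : i ∈ P.part i := P.mem_part_self.mpr hi'
  have hj' := notMem_of_mem_parts P hmem
  rw [part_adjoinPart, adjoinPart_parts, Finset.prod_image (adjoin_injOn P),
    ← Finset.mul_prod_erase _ _ hmem, ← Finset.mul_prod_erase _ _ hmem,
    show adjoin i j (P.part i) = insert j (P.part i) from if_pos h1,
    Finset.prod_congr rfl fun J hJ => ?_, ← smul_mul_assoc, ← smul_mul_assoc]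
  · congr 1
    have := partTerm_merge h1 hj' (one_pos.trans (hν i hi)) (one_pos.trans (hν j hj))
    have h2 := congrArg (fun F => (1 / 2 : ℚ) • F) this
    simp only [smul_smul] at h2
    convert h2 using 2 <;> ring
  · have hiJ : i ∉ J := fun hiJ => (Finset.mem_erase.mp hJ).1
      (P.eq_of_mem_parts (Finset.mem_of_mem_erase hJ) hmem hiJ h1)
    rw [partTerm_merge_of_notMem hiJ, adjoin, if_neg hiJ]

/-- Each $\nu_l$ occurs in $2(|J|-1)$ ordered pairs with weight one half, so the numerators add up
to $|J|-1$ times the denominator. -/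
lemma sum_pairs_part {ν : Fin k → ℕ} {J : Finset (Fin k)} (hJ : J.Nonempty)
    (hν : ∀ i ∈ J, 1 < ν i) :
    ∑ i ∈ J, ∑ j ∈ J.erase i, ((ν i + ν j : ℚ) / 2 / (∑ l ∈ J, ν l : ℕ)) = J.card - 1 := by
  have hpos : (0 : ℚ) < (∑ l ∈ J, ν l : ℕ) := by
    have : 0 < ∑ l ∈ J, ν l := Finset.sum_pos (fun i hi => one_pos.trans (hν i hi)) hJ
    exact_mod_cast this
  have h1 : ∀ i ∈ J, ∑ j ∈ J.erase i, ((ν i + ν j : ℚ) / 2 / (∑ l ∈ J, ν l : ℕ)) =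
      ((J.card - 2 : ℚ) * ν i + (∑ l ∈ J, ν l : ℕ)) / 2 / (∑ l ∈ J, ν l : ℕ) := by
    intro i hi
    rw [← Finset.sum_div, ← Finset.sum_div, Finset.sum_add_distrib, Finset.sum_const,
      Finset.card_erase_of_mem hi, nsmul_eq_mul, Nat.cast_sub (Finset.card_pos.mpr hJ),
      Finset.sum_erase_eq_sub hi]
    congr 2
    push_cast; ring
  rw [Finset.sum_congr rfl h1, ← Finset.sum_div, ← Finset.sum_div, Finset.sum_add_distrib,
    ← Finset.mul_sum, Finset.sum_const, nsmul_eq_mul, ← Nat.cast_sum]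
  field_simp
  ring

lemma sum_pairs_partition {ν : Fin k → ℕ} {s : Finset (Fin k)} (hν : ∀ i ∈ s, 1 < ν i)
    (P : Finpartition s) :
    ∑ i ∈ s, ∑ j ∈ s, (if i ≠ j ∧ j ∈ P.part i then
      ((ν i + ν j : ℚ) / 2 / (∑ l ∈ P.part i, ν l : ℕ)) else 0) = s.card - P.parts.card := by
  have h0 : ∀ f : Fin k → ℚ, ∑ i ∈ s, f i = ∑ J ∈ P.parts, ∑ i ∈ J, f i := by
    intro f
    conv_lhs => rw [← P.biUnion_parts]
    exact Finset.sum_biUnion P.disjoint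
  rw [h0, ← P.sum_card_parts, Nat.cast_sum, Finset.card_eq_sum_ones, Nat.cast_sum,
    ← Finset.sum_sub_distrib]
  refine Finset.sum_congr rfl fun J hJ => ?_
  have hJs := P.subset hJ
  push_cast
  rw [← sum_pairs_part (P.nonempty_of_mem_parts hJ) fun i hi => hν i (hJs hi)]
  refine Finset.sum_congr rfl fun i hi => ?_
  rw [P.part_eq_of_mem hJ hi, ← Finset.sum_filter]
  refine Finset.sum_congr ?_ fun _ _ => by push_cast; rfl
  ext j
  simp only [Finset.mem_filter, Finset.mem_erase]
  exact ⟨fun h => ⟨h.2.1.symm, h.2.2⟩, fun h => ⟨hJs h.2, h.1.symm, h.2⟩⟩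

/-- Adjoining $j$ to the part of $i$ is a bijection from partitions of `s.erase j` to partitions of
`s` in which $i$ and $j$ share a part; it preserves the number of parts. -/
lemma choose_smul_partitionSum_merge {ν : Fin k → ℕ} {s : Finset (Fin k)} (hν : ∀ i ∈ s, 1 < ν i)
    {i j : Fin k} (hi : i ∈ s) (hj : j ∈ s) (hij : i ≠ j) (m : ℕ) :
    ((ν i + ν j).choose (ν i) / 2 : ℚ) • partitionSum (merge ν i j) (s.erase j) m =
      ∑ P : Finpartition s with P.parts.card = m, (if i ≠ j ∧ j ∈ P.part i then
        ((ν i + ν j : ℚ) / 2 / (∑ l ∈ P.part i, ν l : ℕ)) else 0) •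
          ∏ J ∈ P.parts, partTerm ν J := by
  simp only [partitionSum, Finset.smul_sum, ite_smul, zero_smul]
  rw [← Finset.sum_filter]
  refine Finset.sum_bij (fun P _ => adjoinPart hi hj hij P) ?_ ?_ ?_ ?_
  · intro P hP
    simp only [Finset.mem_filter, Finset.mem_univ, true_and] at hP ⊢
    refine ⟨by rw [card_adjoinPart, hP], hij, ?_⟩
    rw [part_adjoinPart]; simp
  · intro P _ Q _ h
    exact adjoinPart_injective hi hj hij h
  · intro P hP
    simp only [Finset.mem_filter, Finset.mem_univ, true_and] at hP
    obtain ⟨Q, rfl⟩ := exists_adjoinPart_eq hi hj hij hP.2.2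
    refine ⟨Q, ?_, rfl⟩
    simpa [card_adjoinPart] using hP.1
  · intro P _
    exact choose_smul_prod_partTerm_merge hν hi hj hij P

lemma sum_choose_smul_partitionSum_merge {ν : Fin k → ℕ} {s : Finset (Fin k)}
    (hν : ∀ i ∈ s, 1 < ν i) (m : ℕ) :
    ∑ i ∈ s, ∑ j ∈ s, (if i = j then 0 else
      ((ν i + ν j).choose (ν i) / 2 : ℚ) • partitionSum (merge ν i j) (s.erase j) m) =
      ((s.card : ℚ) - m) • partitionSum ν s m := by
  have h1 : ∀ i ∈ s, ∀ j ∈ s, (if i = j then 0 else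
      ((ν i + ν j).choose (ν i) / 2 : ℚ) • partitionSum (merge ν i j) (s.erase j) m) =
      ∑ P : Finpartition s with P.parts.card = m, (if i ≠ j ∧ j ∈ P.part i then
        ((ν i + ν j : ℚ) / 2 / (∑ l ∈ P.part i, ν l : ℕ)) else 0) •
          ∏ J ∈ P.parts, partTerm ν J := by
    intro i hi j hj
    split_ifs with hij
    · simp [hij]
    · exact choose_smul_partitionSum_merge hν hi hj hij m
  rw [Finset.sum_congr rfl fun i hi => Finset.sum_congr rfl fun j hj => h1 i hi j hj]
  have h2 : ∀ i ∈ s, ∑ j ∈ s, ∑ P : Finpartition s with P.parts.card = m,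
      (if i ≠ j ∧ j ∈ P.part i then
        ((ν i + ν j : ℚ) / 2 / (∑ l ∈ P.part i, ν l : ℕ)) else 0) •
          ∏ J ∈ P.parts, partTerm ν J = ∑ P : Finpartition s with P.parts.card = m,
      ∑ j ∈ s, (if i ≠ j ∧ j ∈ P.part i then
        ((ν i + ν j : ℚ) / 2 / (∑ l ∈ P.part i, ν l : ℕ)) else 0) •
          ∏ J ∈ P.parts, partTerm ν J := fun i _ => Finset.sum_comm
  rw [Finset.sum_congr rfl h2, Finset.sum_comm, partitionSum, Finset.smul_sum]
  refine Finset.sum_congr rfl fun P hP => ?_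
  have hP : P.parts.card = m := by simpa using hP
  simp only [← Finset.sum_smul]
  rw [sum_pairs_partition hν P, hP]

lemma partitionSum_card (ν : Fin k → ℕ) (s : Finset (Fin k)) :
    partitionSum ν s s.card = ∏ i ∈ s, x (ν i) := by
  rw [partitionSum, Finset.sum_eq_single (⊥ : Finpartition s)]
  · rw [Finpartition.parts_bot, Finset.prod_map]
    refine Finset.prod_congr rfl fun i hi => ?_
    have : ((ν i).factorial : ℚ) ≠ 0 := by positivity
    simp [partTerm, b, dIdx, this]
  · intro P hP hbot
    refine absurd ?_ hbot
    have hP : P.parts.card = s.card := by simpa using hP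
    rw [← P.sum_card_parts, Finset.card_eq_sum_ones] at hP
    have h1 : ∀ J ∈ P.parts, 1 ≤ J.card := fun J hJ =>
      Finset.card_pos.mpr (P.nonempty_of_mem_parts hJ)
    have h2 := (Finset.sum_eq_sum_iff_of_le h1).mp hP
    refine le_bot_iff.mp fun J hJ => ?_
    obtain ⟨a, rfl⟩ := Finset.card_eq_one.mp (h2 J hJ).symm
    exact ⟨{a}, Finpartition.mem_bot_iff.mpr
      ⟨a, P.subset hJ (Finset.mem_singleton_self a), rfl⟩, le_rfl⟩
  · intro h
    simp at h

/-- After one merge, each partition is counted with total weight $|s|-m$ over all pairs. This is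
$j+1$, exactly the new factor in $(j+1)!$. -/
lemma D_pow_prod (g : ℕ) (j : ℕ) : ∀ {ν : Fin k → ℕ} {s : Finset (Fin k)} {m : ℕ},
    (∀ i ∈ s, 1 < ν i) → m + j = s.card →
    (1 / (j.factorial : ℚ)) • (D g ^ j) (∏ i ∈ s, x (ν i)) = partitionSum ν s m := by
  induction j with
  | zero =>
    intro ν s m hν h
    rw [show m = s.card by omega, partitionSum_card]
    simp
  | succ j ih =>
    intro ν s m hν h
    have h1 : ∀ i ∈ s, ∀ l ∈ s, (if i = l then 0 else
        ((ν i + ν l).choose (ν i) / 2 : ℚ) • ((1 / (j.factorial : ℚ)) •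
          (D g ^ j) (∏ t ∈ s.erase l, x (merge ν i l t)))) = (if i = l then 0 else
        ((ν i + ν l).choose (ν i) / 2 : ℚ) • partitionSum (merge ν i l) (s.erase l) m) := by
      intro i hi l hl
      rw [ih (one_lt_merge hν hi hl)]
      rw [Finset.card_erase_of_mem hl]; omega
    have h2 := sum_choose_smul_partitionSum_merge hν m
    rw [← Finset.sum_congr rfl fun i hi => Finset.sum_congr rfl fun l hl => h1 i hi l hl] at h2
    rw [show (s.card : ℚ) - m = j + 1 by rw [← h]; push_cast; ring] at h2
    have h0 : (j + 1 : ℚ) ≠ 0 := by positivity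
    refine smul_right_injective _ h0 ?_
    simp only
    rw [← h2, pow_succ, Module.End.mul_apply, D_prod g hν]
    simp only [map_sum, Finset.smul_sum]
    refine Finset.sum_congr rfl fun i _ => Finset.sum_congr rfl fun l _ => ?_
    split_ifs
    · simp
    rw [map_smul, smul_smul, smul_smul, smul_smul, Nat.factorial_succ]
    congr 1
    push_cast
    field_simp

lemma fourierSum_eq_sum (g n : ℕ) (ν : Fin k → ℕ) : fourierSum g n ν =
    ∑ m ∈ Finset.range (k + 1), x₁div ((g : ℤ) - n - m - ∑ i, (ν i : ℤ)) *
      partitionSum ν Finset.univ m := by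
  unfold fourierSum partitionSum
  have hmaps : ∀ P ∈ (Finset.univ : Finset (Finpartition (Finset.univ : Finset (Fin k)))),
      P.parts.card ∈ Finset.range (k + 1) := fun P _ => by
    have := P.card_parts_le_card
    simp at this ⊢
    omega
  rw [← Finset.sum_fiberwise_of_maps_to hmaps]
  refine Finset.sum_congr rfl fun m _ => ?_
  rw [Finset.mul_sum]
  refine Finset.sum_congr rfl fun P hP => ?_
  have hP : P.parts.card = m := by simpa using hP
  rw [hP, ← mul_smul_comm]
  congr 1
  simp only [partTerm]
  rw [Finset.prod_smul]

/-- Partitions into $m$ parts match the term $j=k-m$; terms with $j>k$ vanish, so the truncation `N`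
is free. -/
lemma fourierSum_eq_expSum (g n : ℕ) {N : ℕ} {ν : Fin k → ℕ} (hν : ∀ i, 1 < ν i) (hN : k < N) :
    fourierSum g n ν =
      expSum g N ((g : ℤ) - ∑ i, (ν i : ℤ) - k - n) (∏ i, x (ν i)) := by
  obtain ⟨M, rfl⟩ : ∃ M, N = k + 1 + M := ⟨N - (k + 1), by omega⟩
  rw [fourierSum_eq_sum, ← Finset.sum_range_reflect, expSum_apply, Finset.sum_range_add _ (k + 1) M,
    Finset.sum_eq_zero (s := Finset.range M), add_zero]
  · refine Finset.sum_congr rfl fun j hj => ?_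
    have hj : j < k + 1 := Finset.mem_range.mp hj
    rw [← mul_smul_comm, D_pow_prod g j (m := k - j) (fun i _ => hν i) (by simp; omega),
      show k + 1 - 1 - j = k - j by omega]
    congr 2
    push_cast [show j ≤ k by omega]
    ring
  · intro j _
    rw [D_pow_prod_eq_zero' g (fun i _ => hν i) (by simp; omega), mul_zero, smul_zero]

/-! ### Monomials as $x_1^n$ times variables of index greater than one -/

section Monomials

variable {k : ℕ}

/-- The exponent of the monomial `∏ x_{ν_i}`. -/
def expo (ν : Fin k → ℕ) : ℕ+ →₀ ℕ := ∑ i, Finsupp.single (ν i).toPNat' 1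

lemma monomial_expo (ν : Fin k → ℕ) : monomial (expo ν) (1 : ℚ) = ∏ i, x (ν i) := by
  unfold expo
  rw [monomial_sum_one]
  rfl

lemma expo_one {ν : Fin k → ℕ} (hν : ∀ i, 1 < ν i) : expo ν 1 = 0 := by
  unfold expo
  rw [Finsupp.finsetSum_apply]
  refine Finset.sum_eq_zero fun i _ => ?_
  have h : (ν i).toPNat' ≠ 1 := fun h => by
    have h2 := congrArg PNat.val h
    rw [Nat.toPNat'_coe, if_pos (one_pos.trans (hν i))] at h2
    exact (hν i).ne' h2
  simp [h]

lemma weight_expo {M : Type*} [AddCommMonoid M] (u : ℕ+ → M) (ν : Fin k → ℕ) :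
    Finsupp.weight u (expo ν) = ∑ i, u (ν i).toPNat' := by
  unfold expo
  simp [map_sum, Finsupp.weight_single]

lemma degree_expo (ν : Fin k → ℕ) : (expo ν).degree = k := by
  unfold expo
  simp [map_sum]

lemma exists_eq_expo (m : ℕ+ →₀ ℕ) (h : m 1 = 0) :
    ∃ (k : ℕ) (ν : Fin k → ℕ), (∀ i, 1 < ν i) ∧ m = expo ν := by
  induction m using Finsupp.induction_linear with
  | zero => exact ⟨0, ![], by simp, by simp [expo]⟩
  | add m₁ m₂ h₁ h₂ =>
    rw [Finsupp.add_apply] at h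
    obtain ⟨k, ν, hν, rfl⟩ := h₁ (by omega)
    obtain ⟨l, μ, hμ, rfl⟩ := h₂ (by omega)
    refine ⟨k + l, Fin.append ν μ, fun i => ?_, ?_⟩
    · induction i using Fin.addCases with
      | left i => simpa using hν i
      | right i => simpa using hμ i
    · unfold expo
      rw [Fin.sum_univ_add]
      simp
  | single a n =>
    refine ⟨n, fun _ => a, fun i => ?_, by simp [expo]⟩
    have hn : n ≠ 0 := by rintro rfl; exact i.elim0
    have ha : a ≠ 1 := by rintro rfl; simp at h; exact hn h
    have := a.pos
    have : (a : ℕ) ≠ 1 := fun h => ha (PNat.coe_injective h)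
    change 1 < (a : ℕ)
    omega

lemma exists_eq_single_add_expo (m : ℕ+ →₀ ℕ) : ∃ (n k : ℕ) (ν : Fin k → ℕ), (∀ i, 1 < ν i) ∧
    m = Finsupp.single 1 n + expo ν := by
  obtain ⟨k, ν, hν, h⟩ := exists_eq_expo (m.erase 1) (by simp)
  exact ⟨m 1, k, ν, hν, by rw [← h, Finsupp.single_add_erase]⟩

lemma monomial_single_add_expo (n : ℕ) (ν : Fin k → ℕ) :
    monomial (Finsupp.single 1 n + expo ν) (1 : ℚ) =
      (n.factorial : ℚ) • (x₁div n * ∏ i, x (ν i)) := by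
  have h0 : (n.factorial : ℚ) ≠ 0 := by positivity
  rw [← mul_one (1 : ℚ), ← monomial_mul, monomial_expo, x₁div_natCast, smul_mul_assoc, smul_smul,
    mul_one_div_cancel h0, one_smul, ← X_pow_eq_monomial, ← x_pnat]
  rfl

lemma weight_single_add_expo (n : ℕ) {ν : Fin k → ℕ} (hν : ∀ i, 1 < ν i) :
    Finsupp.weight wt (Finsupp.single 1 n + expo ν) = n + ∑ i, ν i := by
  rw [map_add, weight_expo, Finsupp.weight_single]
  have h : ∀ i, wt (ν i).toPNat' = ν i := fun i => by
    rw [wt, Nat.toPNat'_coe, if_pos (one_pos.trans (hν i))]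
  simp only [h]
  simp [wt]

lemma span_x₁div_mul_prod : Submodule.span ℚ {F : Poly | ∃ (n k : ℕ) (ν : Fin k → ℕ),
    (∀ i, 1 < ν i) ∧ F = x₁div n * ∏ i, x (ν i)} = ⊤ := by
  rw [eq_top_iff, ← (basisMonomials ℕ+ ℚ).span_eq, Submodule.span_le]
  rintro _ ⟨m, rfl⟩
  obtain ⟨n, k, ν, hν, rfl⟩ := exists_eq_single_add_expo m
  rw [coe_basisMonomials]
  simp only
  rw [monomial_single_add_expo]
  exact Submodule.smul_mem _ _ (Submodule.subset_span ⟨n, k, ν, hν, rfl⟩)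

lemma linearMap_ext {M : Type*} [AddCommGroup M] [Module ℚ M] {A B : Poly →ₗ[ℚ] M}
    (h : ∀ (n k : ℕ) (ν : Fin k → ℕ), (∀ i, 1 < ν i) →
      A (x₁div n * ∏ i, x (ν i)) = B (x₁div n * ∏ i, x (ν i))) : A = B := by
  refine LinearMap.ext_on span_x₁div_mul_prod ?_
  rintro _ ⟨n, k, ν, hν, rfl⟩
  exact h n k ν hν

end Monomials

/-! ### Equality of `I g` with the intersection of images -/

lemma hOp_prod_univ (g : ℕ) {k : ℕ} {ν : Fin k → ℕ} (hν : ∀ i, 1 < ν i) :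
    hOp g (∏ i, x (ν i)) = -((g - ∑ i, (ν i : ℤ) - k : ℤ) : ℚ) • ∏ i, x (ν i) := by
  have := hOp_prod g (s := Finset.univ) fun i _ => one_pos.trans (hν i)
  simpa using this

/-- With $c=g-\sum\nu_i-k$ and $D^kw=0$, the bound $k\le n-c$ says precisely that the degree is at
least $g$. For $k=0$ only $D\,1=0$ is available, which costs one more and excludes $x_1^g$. -/
lemma x₁div_mul_prod_mem_imD {g n k : ℕ} {ν : Fin k → ℕ} (hν : ∀ i, 1 < ν i)
    (h : g ≤ n + ∑ i, ν i) (h' : g < n + ∑ i, ν i ∨ n < g) :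
    x₁div n * ∏ i, x (ν i) ∈ imD g := by
  rw [mem_imD]
  intro N
  have hcast : ∑ i, (ν i : ℤ) = ((∑ i, ν i : ℕ) : ℤ) := by push_cast; rfl
  rcases Nat.eq_zero_or_pos k with rfl | hk
  · refine x₁div_mul_mem_range g N 1 (hOp_prod_univ g hν) (by simp [D_one]) ?_
    simp at h h' ⊢
    omega
  · refine x₁div_mul_mem_range g N k (hOp_prod_univ g hν)
      (D_pow_prod_eq_zero g k (fun i _ => hν i) ⟨⟨0, hk⟩, by simp⟩ (by simp)) ?_
    rw [hcast]
    omega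

lemma I_le_imD (g : ℕ) : I g ≤ imD g := by
  have hmon : ∀ m : ℕ+ →₀ ℕ, g ≤ Finsupp.weight wt m → (g < Finsupp.weight wt m ∨ m 1 < g) →
      monomial m (1 : ℚ) ∈ imD g := by
    intro m h h'
    obtain ⟨n, k, ν, hν, rfl⟩ := exists_eq_single_add_expo m
    rw [weight_single_add_expo n hν] at h h'
    rw [monomial_single_add_expo]
    refine Submodule.smul_mem _ _ (x₁div_mul_prod_mem_imD hν h ?_)
    simpa [expo_one hν] using h'
  refine Submodule.span_le.mpr ?_
  rintro F (⟨d, m, hm, hm1, rfl⟩ | ⟨n, hn, hF⟩)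
  · have := hmon m hm.ge (Or.inr hm1)
    induction d with
    | zero => simpa using this
    | succ d ih =>
      rw [pow_succ', Module.End.mul_apply]
      exact D_mem_imD ih
  · rw [SetLike.mem_coe, F.as_sum]
    refine sum_mem fun m hm => ?_
    have hw : Finsupp.weight wt m = n := hF (mem_support_iff.mp hm)
    rw [← mul_one (coeff m F), ← smul_eq_mul, ← smul_monomial]
    exact Submodule.smul_mem _ _ (hmon m (by omega) (Or.inl (by omega)))

lemma isWeightedHomogeneous_x {n : ℕ} (h : 0 < n) : IsWeightedHomogeneous wt (x n) n := by
  rw [x_of_pos h]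
  exact isWeightedHomogeneous_X ℚ wt (⟨n, h⟩ : ℕ+)

lemma isWeightedHomogeneous_x₁div_mul (n : ℕ) {e : ℕ} {w : Poly}
    (hw : IsWeightedHomogeneous wt w e) : IsWeightedHomogeneous wt (x₁div n * w) (n + e) := by
  rw [x₁div_natCast, smul_mul_assoc]
  refine (weightedHomogeneousSubmodule ℚ wt (n + e)).smul_mem _ ?_
  have := (isWeightedHomogeneous_x one_pos).pow n
  rw [smul_eq_mul, mul_one] at this
  exact this.mul hw

lemma isWeightedHomogeneous_prod {ι : Type*} {ν : ι → ℕ} {s : Finset ι} (hν : ∀ i ∈ s, 1 < ν i) :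
    IsWeightedHomogeneous wt (∏ i ∈ s, x (ν i)) (∑ i ∈ s, ν i) :=
  IsWeightedHomogeneous.prod _ _ _ fun i hi => isWeightedHomogeneous_x (one_pos.trans (hν i hi))

lemma isWeightedHomogeneous_D (g : ℕ) {e : ℕ} {F : Poly} (hF : IsWeightedHomogeneous wt F (e + 1)) :
    IsWeightedHomogeneous wt (D g F) e := by
  rw [F.as_sum, map_sum]
  refine (weightedHomogeneousSubmodule ℚ wt e).sum_mem fun m hm => ?_
  have hw : Finsupp.weight wt m = e + 1 := hF (mem_support_iff.mp hm)
  rw [← mul_one (coeff m F), ← smul_eq_mul, ← smul_monomial, map_smul]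
  refine (weightedHomogeneousSubmodule ℚ wt e).smul_mem _ ?_
  obtain ⟨n, k, ν, hν, rfl⟩ := exists_eq_single_add_expo m
  rw [weight_single_add_expo n hν] at hw
  rw [monomial_single_add_expo, map_smul]
  refine (weightedHomogeneousSubmodule ℚ wt e).smul_mem _ ?_
  rw [D_x₁div_mul g (hOp_prod_univ g hν)]
  refine (weightedHomogeneousSubmodule ℚ wt e).add_mem
    ((weightedHomogeneousSubmodule ℚ wt e).smul_mem _ ?_) ?_
  · cases n with
    | zero => rw [x₁div_of_neg (by simp), zero_mul]; exact Submodule.zero_mem _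
    | succ n =>
      have := isWeightedHomogeneous_x₁div_mul n
        (isWeightedHomogeneous_prod (s := Finset.univ) fun i _ => hν i)
      rw [show n + ∑ i, ν i = e by omega] at this
      simpa using this
  · rw [D_prod g fun i _ => hν i, Finset.mul_sum]
    refine Submodule.sum_mem _ fun i hi => ?_
    rw [Finset.mul_sum]
    refine Submodule.sum_mem _ fun j hj => ?_
    split_ifs with hij
    · rw [mul_zero]; exact Submodule.zero_mem _
    rw [mul_smul_comm]
    refine Submodule.smul_mem _ _ ?_
    have h1 := isWeightedHomogeneous_x₁div_mul n
      (isWeightedHomogeneous_prod (one_lt_merge (fun i _ => hν i) hi hj))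
    have h2 := sum_merge (ν := ν) hi hj hij (one_pos.trans (hν i))
    rwa [show n + ∑ k ∈ Finset.univ.erase j, merge ν i j k = e by omega] at h1

lemma coeff_mul_prod {ι : Type*} [DecidableEq ι] {ν : ι → ℕ} {s : Finset ι}
    (hν : ∀ i ∈ s, 1 < ν i) (hs : s.Nonempty) (Q : Poly) (n : ℕ) :
    coeff (Finsupp.single 1 n) (Q * ∏ i ∈ s, x (ν i)) = 0 := by
  obtain ⟨i, hi⟩ := hs
  have hνi := hν i hi
  obtain ⟨l, hl⟩ : ∃ l : ℕ+, (l : ℕ) = ν i := ⟨⟨ν i, one_pos.trans hνi⟩, rfl⟩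
  rw [← Finset.prod_erase_mul _ _ hi, ← mul_assoc, ← hl, x_pnat, coeff_mul_X', if_neg]
  intro h
  have h2 := Finsupp.support_single_subset h
  rw [Finset.mem_singleton] at h2
  subst h2
  simp [← hl] at hνi

/-- Here $Dx_1^{[n+1]}=(n-g)x_1^{[n]}$ vanishes at $n=g$, and every other monomial keeps a variable
besides $x_1$. -/
lemma coeff_D (g : ℕ) (F : Poly) : coeff (Finsupp.single 1 g) (D g F) = 0 := by
  suffices h : lcoeff ℚ (Finsupp.single 1 g) ∘ₗ D g = 0 from LinearMap.congr_fun h F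
  refine linearMap_ext fun n k ν hν => ?_
  simp only [LinearMap.comp_apply, lcoeff_apply, LinearMap.zero_apply]
  rw [D_x₁div_mul g (hOp_prod_univ g hν), coeff_add, coeff_smul]
  rcases Nat.eq_zero_or_pos k with rfl | hk
  · simp only [Finset.univ_eq_empty, Finset.prod_empty, mul_one, D_one, mul_zero, coeff_zero,
      add_zero]
    cases n with
    | zero => rw [x₁div_of_neg (by simp)]; simp
    | succ n =>
      rw [show ((n + 1 : ℕ) : ℤ) - 1 = n by push_cast; ring, x₁div_natCast, coeff_smul,
        show x 1 = X (1 : ℕ+) from x_pnat 1, coeff_X_pow]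
      split_ifs with h
      · have : n = g := Finsupp.single_injective _ h
        subst this
        simp
      · simp
  · have hne : (Finset.univ : Finset (Fin k)).Nonempty := ⟨⟨0, hk⟩, by simp⟩
    rw [coeff_mul_prod (fun i _ => hν i) hne, smul_zero, zero_add, D_prod g fun i _ => hν i]
    simp only [Finset.mul_sum, coeff_sum]
    refine Finset.sum_eq_zero fun i hi => Finset.sum_eq_zero fun j hj => ?_
    split_ifs with hij
    · simp
    rw [mul_smul_comm, coeff_smul, coeff_mul_prod (one_lt_merge (fun i _ => hν i) hi hj)
      ⟨i, by simp [hij]⟩, smul_zero]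

lemma D_pow_mem_I {g : ℕ} {F : Poly} (hF : IsWeightedHomogeneous wt F g)
    (h : coeff (Finsupp.single 1 g) F = 0) (d : ℕ) : (D g ^ d) F ∈ I g := by
  rw [F.as_sum, map_sum]
  refine sum_mem fun m hm => ?_
  have hm := mem_support_iff.mp hm
  have hw : Finsupp.weight wt m = g := hF hm
  rw [← mul_one (coeff m F), ← smul_eq_mul, ← smul_monomial, map_smul]
  refine Submodule.smul_mem _ _ (Submodule.subset_span (Or.inl ⟨d, m, hw, ?_, rfl⟩))
  obtain ⟨n, k, ν, hν, rfl⟩ := exists_eq_single_add_expo m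
  rw [weight_single_add_expo n hν] at hw
  rw [Finsupp.add_apply, expo_one hν]
  simp only [Finsupp.single_eq_same, add_zero]
  by_contra hn
  have hk : k = 0 := by
    by_contra hk
    have : ν ⟨0, by omega⟩ ≤ ∑ i, ν i := Finset.single_le_sum (by simp) (Finset.mem_univ _)
    have := hν ⟨0, by omega⟩
    omega
  subst hk
  simp at hw
  subst hw
  simp [expo] at hm
  exact hm h

lemma isWeightedHomogeneous_D_pow (g : ℕ) (j : ℕ) : ∀ {e : ℕ} {F : Poly},
    IsWeightedHomogeneous wt F (e + j) → IsWeightedHomogeneous wt ((D g ^ j) F) e := by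
  induction j with
  | zero => intro e F h; simpa using h
  | succ j ih =>
    intro e F h
    rw [pow_succ, Module.End.mul_apply]
    exact ih (isWeightedHomogeneous_D g (e := e + j) h)

lemma D_of_isWeightedHomogeneous_zero (g : ℕ) {F : Poly} (hF : IsWeightedHomogeneous wt F 0) :
    D g F = 0 := by
  rw [F.as_sum, map_sum]
  refine Finset.sum_eq_zero fun m hm => ?_
  have hw : Finsupp.weight wt m = 0 := hF (mem_support_iff.mp hm)
  have : m = 0 := by
    ext i
    have := Finsupp.le_weight wt (s := i) (by simp [wt]) m
    simp at this ⊢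
    omega
  subst this
  rw [← mul_one (coeff 0 F), ← smul_eq_mul, ← smul_monomial, map_smul]
  rw [show monomial (0 : ℕ+ →₀ ℕ) (1 : ℚ) = 1 from rfl, D_one, smul_zero]

lemma imD_le_I (g : ℕ) : imD g ≤ I g := by
  intro F hF
  obtain ⟨G, rfl⟩ := mem_imD.mp hF (g + 1)
  clear hF
  rw [G.as_sum, map_sum]
  refine sum_mem fun m _ => ?_
  have hm := isWeightedHomogeneous_monomial wt m (coeff m G) rfl
  generalize monomial m (coeff m G) = P at hm
  generalize Finsupp.weight wt m = e at hm
  rcases lt_or_ge e (g + 1) with he | he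
  · have h1 := isWeightedHomogeneous_D_pow g e (e := 0) (by simpa using hm)
    rw [show g + 1 = (g - e) + 1 + e by omega, pow_add, Module.End.mul_apply, pow_succ,
      Module.End.mul_apply, D_of_isWeightedHomogeneous_zero g h1, map_zero]
    exact zero_mem _
  · obtain ⟨r, rfl⟩ := Nat.exists_eq_add_of_le he
    rcases lt_or_ge g r with hr | hr
    · exact Submodule.subset_span (Or.inr ⟨r, hr,
        isWeightedHomogeneous_D_pow g (g + 1) (by rwa [add_comm])⟩)
    · have h1 := isWeightedHomogeneous_D_pow g r hm
      -- $D^r$ brings the degree down to $g+1$; the next $D$ lands in degree $g$ without an $x_1^g$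
      -- term, where the generators of `I g` start.
      rw [show g + 1 = (g - r) + 1 + r by omega, pow_add, Module.End.mul_apply, pow_succ,
        Module.End.mul_apply]
      exact D_pow_mem_I (isWeightedHomogeneous_D g h1) (coeff_D g _) _

lemma I_eq_imD (g : ℕ) : I g = imD g := le_antisymm (I_le_imD g) (imD_le_I g)

/-! ### The Fourier operator on polynomials and its relations with $x_1$, $h$, $D$ -/

/-- The Fourier operator on `Poly`, given by the explicit formula on monomials. -/
def fourier (g : ℕ) : Module.End ℚ Poly :=
  (basisMonomials ℕ+ ℚ).constr ℚ fun m => ((-1 : ℚ) ^ m 1 * (m 1).factorial) •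
    expSum g ((m.erase 1).degree + 1)
      ((g : ℤ) - Finsupp.weight (fun i : ℕ+ => (i : ℤ) + 1) (m.erase 1) - m 1)
      (monomial (m.erase 1) 1)

section

variable {k : ℕ} {ν : Fin k → ℕ}

lemma erase_single_add_expo (n : ℕ) (hν : ∀ i, 1 < ν i) :
    (Finsupp.single 1 n + expo ν).erase 1 = expo ν := by
  rw [Finsupp.erase_add, Finsupp.erase_single, zero_add, Finsupp.erase_of_notMem_support]
  simp [expo_one hν]

lemma fourier_x₁div_mul_prod (g n : ℕ) (hν : ∀ i, 1 < ν i) :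
    fourier g (x₁div n * ∏ i, x (ν i)) = (-1 : ℚ) ^ n • fourierSum g n ν := by
  have h0 : (n.factorial : ℚ) ≠ 0 := by positivity
  have h1 : x₁div n * ∏ i, x (ν i) = (1 / n.factorial : ℚ) •
      basisMonomials ℕ+ ℚ (Finsupp.single 1 n + expo ν) := by
    rw [coe_basisMonomials]
    simp only
    rw [monomial_single_add_expo, smul_smul, one_div_mul_cancel h0, one_smul]
  have h2 : Finsupp.weight (fun i : ℕ+ => (i : ℤ) + 1) (expo ν) = ∑ i, (ν i : ℤ) + k := by
    have h : ∀ i, (((ν i).toPNat' : ℕ) : ℤ) = ν i := fun i => by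
      rw [Nat.toPNat'_coe, if_pos (one_pos.trans (hν i))]
    rw [weight_expo]
    simp only [h]
    simp [Finset.sum_add_distrib]
  rw [h1, map_smul, fourier, Module.Basis.constr_basis, erase_single_add_expo n hν, smul_smul, h2,
    degree_expo, monomial_expo, fourierSum_eq_expSum g n hν (Nat.lt_succ_self k),
    Finsupp.add_apply, expo_one hν]
  simp only [Finsupp.single_eq_same, add_zero]
  rw [← sub_sub]
  congr 1
  field_simp

lemma fourier_eq_expSum (g n : ℕ) {N : ℕ} (hν : ∀ i, 1 < ν i) (hN : k < N) :
    fourier g (x₁div n * ∏ i, x (ν i)) =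
      (-1 : ℚ) ^ n • expSum g N ((g : ℤ) - ∑ i, (ν i : ℤ) - k - n) (∏ i, x (ν i)) := by
  rw [fourier_x₁div_mul_prod g n hν, fourierSum_eq_expSum g n hν hN]

lemma D_pow_prod_univ (g : ℕ) {N : ℕ} (hν : ∀ i, 1 < ν i) (hN : k < N) :
    (D g ^ N) (∏ i, x (ν i)) = 0 :=
  D_pow_prod_eq_zero' g (fun i _ => hν i) (by simpa using hN)

/-- The terms with $j<k$ carry a negative divided power of $x_1$, and the term $j=k>0$ contains
$D^kw=0$. -/
lemma fourier_eq_zero (g n : ℕ) (hν : ∀ i, 1 < ν i) (h : g ≤ n + ∑ i, ν i)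
    (h' : g < n + ∑ i, ν i ∨ n < g) : fourier g (x₁div n * ∏ i, x (ν i)) = 0 := by
  rw [fourier_eq_expSum g n hν (Nat.lt_succ_self k), expSum_apply, Finset.sum_eq_zero, smul_zero]
  intro j hj
  have hcast : ∑ i, (ν i : ℤ) = ((∑ i, ν i : ℕ) : ℤ) := by push_cast; rfl
  have hj : j < k + 1 := Finset.mem_range.mp hj
  rcases Nat.eq_zero_or_pos k with rfl | hk
  · rw [x₁div_of_neg, zero_mul, smul_zero]
    simp at h h' ⊢
    omega
  · rcases eq_or_ne j k with rfl | hjk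
    · rw [D_pow_prod_eq_zero g j (fun i _ => hν i) ⟨⟨0, hk⟩, by simp⟩ (by simp), mul_zero,
        smul_zero]
    · rw [x₁div_of_neg, zero_mul, smul_zero]
      rw [hcast]
      omega

end

/-- The products of `k` variables other than `x₁` which lie in the weight space `-c`. -/
def prods (g k : ℕ) (c : ℤ) : Submodule ℚ Poly := Submodule.span ℚ
  {F | ∃ ν : Fin k → ℕ, (∀ i, 1 < ν i) ∧ (g : ℤ) - ∑ i, (ν i : ℤ) - k = c ∧ F = ∏ i, x (ν i)}

lemma fourier_of_mem_prods {g k n N : ℕ} {c : ℤ} {w : Poly} (hw : w ∈ prods g k c) (hN : k < N) :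
    fourier g (x₁div n * w) = (-1 : ℚ) ^ n • expSum g N (c - n) w := by
  induction hw using Submodule.span_induction with
  | mem w h =>
    obtain ⟨ν, hν, rfl, rfl⟩ := h
    exact fourier_eq_expSum g n hν hN
  | zero => simp
  | add F G _ _ hF hG => rw [mul_add, map_add, map_add, hF, hG, smul_add]
  | smul a F _ hF => rw [mul_smul_comm, map_smul, map_smul, hF, smul_comm]

lemma prod_mem_prods {ι : Type*} [DecidableEq ι] {g : ℕ} {ν : ι → ℕ} {s : Finset ι}
    (hν : ∀ i ∈ s, 1 < ν i) {c : ℤ} (hc : (g : ℤ) - ∑ i ∈ s, (ν i : ℤ) - s.card = c) :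
    ∏ i ∈ s, x (ν i) ∈ prods g s.card c := by
  refine Submodule.subset_span ⟨fun i => ν (s.equivFin.symm i), fun i => hν _ (by simp), ?_, ?_⟩
  · rw [Equiv.sum_comp s.equivFin.symm (fun i : s => (ν i : ℤ)),
      Finset.sum_coe_sort s fun i => (ν i : ℤ), hc]
  · rw [Equiv.prod_comp s.equivFin.symm (fun i : s => x (ν i)),
      Finset.prod_coe_sort s fun i => x (ν i)]

lemma D_prod_mem_prods (g : ℕ) {k : ℕ} {ν : Fin k → ℕ} (hν : ∀ i, 1 < ν i) :
    D g (∏ i, x (ν i)) ∈ prods g (k - 1) ((g : ℤ) - ∑ i, (ν i : ℤ) - k + 2) := by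
  rw [D_prod g fun i _ => hν i]
  refine Submodule.sum_mem _ fun i hi => Submodule.sum_mem _ fun j hj => ?_
  split_ifs with hij
  · exact Submodule.zero_mem _
  refine Submodule.smul_mem _ _ ?_
  have hk : 0 < k := i.pos
  have h1 := prod_mem_prods (g := g) (one_lt_merge (fun i _ => hν i) hi hj) rfl
  have h2 := sum_merge (ν := ν) hi hj hij (one_pos.trans (hν i))
  have h3 : (Finset.univ.erase j).card = k - 1 := by simp
  rw [h3] at h1
  convert h1 using 2
  have h4 : ∑ i, (ν i : ℤ) = ((∑ i, ν i : ℕ) : ℤ) := by push_cast; rfl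
  rw [h4, ← h2]
  push_cast [show 1 ≤ k by omega]
  ring

lemma fourier_x_one_mul (g : ℕ) (F : Poly) : fourier g (x 1 * F) = D g (fourier g F) := by
  suffices h : fourier g ∘ₗ LinearMap.mulLeft ℚ (x 1) = D g ∘ₗ fourier g from
    LinearMap.congr_fun h F
  refine linearMap_ext fun n k ν hν => ?_
  simp only [LinearMap.comp_apply, LinearMap.mulLeft_apply]
  have h1 := x_one_mul_x₁div n
  rw [← mul_assoc, h1, smul_mul_assoc, map_smul]
  have h2 := fourier_eq_expSum g (n + 1) hν (Nat.lt_succ_self k)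
  push_cast at h2
  rw [h2, fourier_eq_expSum g n hν (Nat.lt_succ_self k), map_smul,
    D_expSum g (hOp_prod_univ g hν) (D_pow_prod_univ g hν (Nat.lt_succ_self k)), smul_smul,
    smul_smul, sub_sub ((g : ℤ) - _ - _)]
  congr 1
  push_cast
  ring

lemma hOp_expSum (g N : ℕ) {c : ℤ} {w : Poly} (hw : hOp g w = -(c : ℚ) • w) (e : ℤ) :
    hOp g (expSum g N e w) = (2 * e - c : ℚ) • expSum g N e w := by
  rw [expSum_apply, map_sum, Finset.smul_sum]
  refine Finset.sum_congr rfl fun j _ => ?_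
  rw [map_smul, hOp_x₁div_mul g (hOp_D_pow_of_eigen g hw j), smul_comm]
  congr 1
  push_cast; ring

lemma hOp_fourier (g : ℕ) (F : Poly) : hOp g (fourier g F) = -fourier g (hOp g F) := by
  suffices h : hOp g ∘ₗ fourier g = -(fourier g ∘ₗ hOp g) from LinearMap.congr_fun h F
  refine linearMap_ext fun n k ν hν => ?_
  have hw := hOp_prod_univ g hν
  simp only [LinearMap.comp_apply, LinearMap.neg_apply]
  rw [hOp_x₁div_mul g hw, map_smul, fourier_eq_expSum g n hν (Nat.lt_succ_self k), map_smul,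
    hOp_expSum g _ hw, smul_comm, ← neg_smul]
  congr 1
  push_cast; ring

/-- On $x_1^{[n]}w$ with $n\ge 1$ the two sides agree exactly. At $n=0$ the term with $x_1^{[-1]}$
is missing, and the defect is $-(c+1)$ times the sum covered by `expSum_mem_imD`. -/
lemma fourier_D_sub_mem (g : ℕ) (F : Poly) :
    fourier g (D g F) - x 1 * fourier g F ∈ imD g := by
  suffices h : (imD g).mkQ ∘ₗ fourier g ∘ₗ D g =
      (imD g).mkQ ∘ₗ LinearMap.mulLeft ℚ (x 1) ∘ₗ fourier g by
    have := LinearMap.congr_fun h F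
    exact (Submodule.Quotient.eq _).mp this
  refine linearMap_ext fun n k ν hν => ?_
  simp only [LinearMap.comp_apply, LinearMap.mulLeft_apply]
  have hw := hOp_prod_univ g hν
  have hN := D_pow_prod_univ g hν (Nat.lt_succ_self k)
  have hD := D_prod_mem_prods g hν
  generalize hc : (g : ℤ) - ∑ i, (ν i : ℤ) - k = c at *
  have h1 : fourier g (x₁div n * D g (∏ i, x (ν i))) = (-1 : ℚ) ^ n •
      ∑ j ∈ Finset.range (k + 1), ((j : ℚ) / (j.factorial : ℚ)) •
        (x₁div (c + 1 - n + j) * (D g ^ j) (∏ i, x (ν i))) := by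
    rw [fourier_of_mem_prods hD (show k - 1 < k + 1 by omega), expSum_apply]
    congr 1
    have h1 := Finset.sum_range_succ (fun j : ℕ => ((j : ℚ) / (j.factorial : ℚ)) •
        (x₁div (c + 1 - n + j) * (D g ^ j) (∏ i, x (ν i)))) (k + 1)
    rw [hN, mul_zero, smul_zero, add_zero, Finset.sum_range_succ'] at h1
    simp only [Nat.cast_zero, zero_div, zero_smul, add_zero] at h1
    rw [← h1]
    refine Finset.sum_congr rfl fun j _ => ?_
    rw [pow_succ (D g), Module.End.mul_apply, Nat.factorial_succ]
    congr 1
    · push_cast; field_simp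
    · congr 2; push_cast; ring
  have h2 : x 1 * fourier g (x₁div n * ∏ i, x (ν i)) = (-1 : ℚ) ^ n •
      ∑ j ∈ Finset.range (k + 1), ((c - n + j + 1 : ℚ) / (j.factorial : ℚ)) •
        (x₁div (c + 1 - n + j) * (D g ^ j) (∏ i, x (ν i))) := by
    rw [fourier_eq_expSum g n hν (Nat.lt_succ_self k), hc, expSum_apply, mul_smul_comm,
      Finset.mul_sum]
    congr 1
    refine Finset.sum_congr rfl fun j _ => ?_
    rw [mul_smul_comm, ← mul_assoc, x_one_mul_x₁div, smul_mul_assoc, smul_smul]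
    congr 1
    · push_cast; ring
    · congr 2; ring
  rw [D_x₁div_mul g hw, map_add, map_smul]
  cases n with
  | zero =>
    rw [x₁div_of_neg (show ((0 : ℕ) : ℤ) - 1 < 0 by norm_num), zero_mul, map_zero, smul_zero,
      zero_add]
    refine (Submodule.Quotient.eq _).mpr ?_
    have h3 : fourier g (x₁div (0 : ℕ) * D g (∏ i, x (ν i))) -
        x 1 * fourier g (x₁div (0 : ℕ) * ∏ i, x (ν i)) =
          (-(c + 1 : ℚ)) • expSum g (k + 1) (c + 1) (∏ i, x (ν i)) := by
      rw [h1, h2, expSum_apply, ← smul_sub, ← Finset.sum_sub_distrib, pow_zero, one_smul,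
        Finset.smul_sum]
      refine Finset.sum_congr rfl fun j _ => ?_
      rw [← sub_smul, smul_smul]
      congr 1
      · push_cast; ring
      · simp
    rw [h3]
    exact Submodule.smul_mem _ _ (expSum_mem_imD g hw hN)
  | succ n =>
    congr 1
    rw [h1, h2, show ((n + 1 : ℕ) : ℤ) - 1 = n by push_cast; ring,
      fourier_eq_expSum g n hν (Nat.lt_succ_self k), hc, expSum_apply, smul_smul, pow_succ,
      ← sub_eq_zero, Finset.smul_sum, Finset.smul_sum, Finset.smul_sum, ← Finset.sum_add_distrib,
      ← Finset.sum_sub_distrib]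
    refine Finset.sum_eq_zero fun j _ => ?_
    rw [show c + 1 - ((n + 1 : ℕ) : ℤ) + j = c - n + j by push_cast; ring]
    simp only [smul_smul]
    rw [← add_smul, ← sub_smul]
    convert zero_smul ℚ _ using 2
    push_cast
    field_simp
    ring

/-- The generating monomials of `I g` are annihilated outright; powers of $D$ become multiplications
by $x_1$ modulo the ideal. -/
lemma fourier_mem_imD {g : ℕ} {F : Poly} (hF : F ∈ imD g) : fourier g F ∈ imD g := by
  have hmon : ∀ m : ℕ+ →₀ ℕ, g ≤ Finsupp.weight wt m → (g < Finsupp.weight wt m ∨ m 1 < g) →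
      fourier g (monomial m (1 : ℚ)) = 0 := by
    intro m h h'
    obtain ⟨n, k, ν, hν, rfl⟩ := exists_eq_single_add_expo m
    rw [weight_single_add_expo n hν] at h h'
    rw [monomial_single_add_expo, map_smul, fourier_eq_zero g n hν h, smul_zero]
    simpa [expo_one hν] using h'
  rw [← I_eq_imD] at hF
  refine Submodule.span_le (p := (imD g).comap (fourier g)).mpr ?_ hF
  rintro F (⟨d, m, hm, hm1, rfl⟩ | ⟨n, hn, hF⟩)
  · induction d with
    | zero =>
      change fourier g _ ∈ imD g
      rw [pow_zero, Module.End.one_apply, hmon m hm.ge (Or.inr hm1)]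
      exact zero_mem _
    | succ d ih =>
      change fourier g _ ∈ imD g
      rw [pow_succ', Module.End.mul_apply]
      have := add_mem (fourier_D_sub_mem g ((D g ^ d) (monomial m 1))) (mul_mem_imD (x 1) ih)
      rwa [sub_add_cancel] at this
  · change fourier g _ ∈ imD g
    rw [F.as_sum, map_sum]
    refine sum_mem fun m hm => ?_
    have hw : Finsupp.weight wt m = n := hF (mem_support_iff.mp hm)
    rw [← mul_one (coeff m F), ← smul_eq_mul, ← smul_monomial, map_smul,
      hmon m (by omega) (Or.inl (by omega)), smul_zero]
    exact zero_mem _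

/-! ### The square of the Fourier operator -/

lemma D_mem_prods {g k : ℕ} {c : ℤ} {w : Poly} (hw : w ∈ prods g k c) :
    D g w ∈ prods g (k - 1) (c + 2) := by
  refine Submodule.span_le (p := (prods g (k - 1) (c + 2)).comap (D g)).mpr ?_ hw
  rintro _ ⟨ν, hν, rfl, rfl⟩
  exact D_prod_mem_prods g hν

lemma D_pow_mem_prods {g k : ℕ} {c : ℤ} {w : Poly} (hw : w ∈ prods g k c) (j : ℕ) :
    (D g ^ j) w ∈ prods g (k - j) (c + 2 * j) := by
  induction j with
  | zero => simpa using hw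
  | succ j ih =>
    rw [pow_succ', Module.End.mul_apply]
    have := D_mem_prods ih
    rw [show k - j - 1 = k - (j + 1) by omega] at this
    convert this using 2
    push_cast; ring

lemma sum_neg_one_pow_div_factorial (m : ℕ) :
    ∑ j ∈ Finset.range (m + 1), (-1 : ℚ) ^ j / (j.factorial * (m - j).factorial) =
      if m = 0 then 1 else 0 := by
  have h := congrArg (Int.cast (R := ℚ)) (Int.alternating_sum_range_choose (n := m))
  push_cast at h
  have h0 : (m.factorial : ℚ) ≠ 0 := by positivity
  have h1 : ∑ j ∈ Finset.range (m + 1), (-1 : ℚ) ^ j / (j.factorial * (m - j).factorial) =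
      (1 / m.factorial) * ∑ j ∈ Finset.range (m + 1), (-1 : ℚ) ^ j * m.choose j := by
    rw [Finset.mul_sum]
    refine Finset.sum_congr rfl fun j hj => ?_
    rw [Nat.cast_choose ℚ (Nat.lt_succ_iff.mp (Finset.mem_range.mp hj))]
    field_simp
  rw [h1, h]
  split_ifs with hm
  · subst hm; simp
  · simp

/-- In the double sum $x_1^{[m]}D^mw$ has coefficient $\pm\sum_j(-1)^j/(j!\,(m-j)!)$, which vanishes
unless $m=0$. Since $c=n\ge 0$, no divided power in the first application is cut off. -/
lemma fourier_fourier_prod (g : ℕ) {k n : ℕ} {ν : Fin k → ℕ} (hν : ∀ i, 1 < ν i)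
    (hc : (g : ℤ) - ∑ i, (ν i : ℤ) - k = n) :
    fourier g (fourier g (∏ i, x (ν i))) = (-1 : ℚ) ^ n • ∏ i, x (ν i) := by
  have h1 := fourier_eq_expSum g 0 hν (Nat.lt_succ_self k)
  rw [Nat.cast_zero, x₁div_zero, one_mul, pow_zero, one_smul, sub_zero, hc] at h1
  have hmem : ∏ i, x (ν i) ∈ prods g k n := Submodule.subset_span ⟨ν, hν, hc, rfl⟩
  generalize ∏ i, x (ν i) = w at *
  have h2 : ∀ j ∈ Finset.range (k + 1), fourier g (x₁div ((n : ℤ) + j) * (D g ^ j) w) =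
      (-1 : ℚ) ^ (n + j) • expSum g (k + 1 - j) j ((D g ^ j) w) := by
    intro j hj
    have hj : j < k + 1 := Finset.mem_range.mp hj
    have := fourier_of_mem_prods (n := n + j) (D_pow_mem_prods hmem j)
      (show k - j < k + 1 - j by omega)
    push_cast at this
    rw [this, show (n : ℤ) + 2 * j - (n + j) = j by ring]
  rw [h1, expSum_apply, map_sum]
  simp only [map_smul]
  rw [Finset.sum_congr rfl fun j hj => by rw [h2 j hj]]
  simp only [expSum_apply, Finset.smul_sum]
  have h3 := Finset.sum_range_diag_flip (k + 1) (fun j i : ℕ => (1 / (j.factorial : ℚ)) •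
    (-1 : ℚ) ^ (n + j) • (1 / (i.factorial : ℚ)) •
      (x₁div ((j : ℤ) + i) * (D g ^ i) ((D g ^ j) w)))
  rw [Nat.succ_eq_add_one, ← h3]
  have h4 : ∀ m ∈ Finset.range (k + 1), ∑ j ∈ Finset.range (m + 1), (1 / (j.factorial : ℚ)) •
      (-1 : ℚ) ^ (n + j) • (1 / ((m - j).factorial : ℚ)) •
        (x₁div ((j : ℤ) + (m - j : ℕ)) * (D g ^ (m - j)) ((D g ^ j) w)) =
      if m = 0 then (-1 : ℚ) ^ n • w else 0 := by
    intro m _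
    have h5 : ∀ j ∈ Finset.range (m + 1), (1 / (j.factorial : ℚ)) •
      (-1 : ℚ) ^ (n + j) • (1 / ((m - j).factorial : ℚ)) •
        (x₁div ((j : ℤ) + (m - j : ℕ)) * (D g ^ (m - j)) ((D g ^ j) w)) =
        ((-1 : ℚ) ^ j / (j.factorial * (m - j).factorial)) •
          ((-1 : ℚ) ^ n • (x₁div m * (D g ^ m) w)) := by
      intro j hj
      have hj : j ≤ m := Nat.lt_succ_iff.mp (Finset.mem_range.mp hj)
      rw [← Module.End.mul_apply, ← pow_add, Nat.sub_add_cancel hj,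
        show (j : ℤ) + (m - j : ℕ) = m by push_cast [hj]; ring]
      simp only [smul_smul]
      congr 1
      rw [pow_add]
      field_simp
    rw [Finset.sum_congr rfl h5, ← Finset.sum_smul, sum_neg_one_pow_div_factorial]
    split_ifs with hm
    · subst hm; simp [x₁div_zero]
    · simp
  rw [Finset.sum_congr rfl h4]
  simp

lemma fourier_fourier_x_one_mul (g : ℕ) (F : Poly) :
    fourier g (fourier g (x 1 * F)) - x 1 * fourier g (fourier g F) ∈ imD g := by
  rw [fourier_x_one_mul]
  exact fourier_D_sub_mem g _

lemma fourier_fourier_x_one_mul_sub {g : ℕ} {F : Poly} {a : ℚ}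
    (h : fourier g (fourier g F) - a • F ∈ imD g) :
    fourier g (fourier g (x 1 * F)) - a • (x 1 * F) ∈ imD g := by
  have := add_mem (fourier_fourier_x_one_mul g F) (mul_mem_imD (x 1) h)
  rwa [mul_sub, mul_smul_comm, sub_add_sub_cancel] at this

lemma x₁div_mul_mem_imD (g : ℕ) (F : Poly) : x₁div (g + 1 : ℕ) * F ∈ imD g := by
  rw [mul_comm]
  refine mul_mem_imD F ?_
  have := x₁div_mul_prod_mem_imD (g := g) (n := g + 1) (ν := (![] : Fin 0 → ℕ)) (by simp)
    (by simp) (Or.inl (by simp))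
  simpa using this

/-- This is the $\mathfrak{sl}_2$ fact that a locally nilpotent $e$ maps onto positive weight
spaces. Correcting $F$ by a multiple of $x_1DF$ makes $x_1^{[k]}$ times the result proportional to
$D(x_1^{[k+1]}F)$, so the nilpotency order drops. -/
lemma exists_sub_x_one_mul_mem {g : ℕ} {μ : ℤ} (hμ : 1 ≤ μ) (k : ℕ) : ∀ {F : Poly},
    hOp g F = (μ : ℚ) • F → x₁div k * F ∈ imD g →
    ∃ u, hOp g u = ((μ - 2 : ℤ) : ℚ) • u ∧ F - x 1 * u ∈ imD g := by
  induction k with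
  | zero =>
    intro F _ h
    refine ⟨0, by simp, ?_⟩
    rw [Nat.cast_zero, x₁div_zero, one_mul] at h
    simpa using h
  | succ k ih =>
    intro F hF h
    have hF' : hOp g F = -((-μ : ℤ) : ℚ) • F := by simp [hF]
    have hDF : hOp g (D g F) = ((μ - 2 : ℤ) : ℚ) • D g F := by
      rw [hOp_D_of_eigen g hF']
      congr 1
      push_cast; ring
    have hμk : (μ + k : ℚ) ≠ 0 := by
      have : (0 : ℤ) < μ + k := by omega
      exact_mod_cast this.ne'
    have hk : (k + 1 : ℚ) ≠ 0 := by positivity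
    have h1 : hOp g (F + (1 / ((k + 1) * (μ + k)) : ℚ) • (x 1 * D g F)) =
        (μ : ℚ) • (F + (1 / ((k + 1) * (μ + k)) : ℚ) • (x 1 * D g F)) := by
      rw [map_add, map_smul, hOp_x_mul g one_pos, hF, hDF, mul_smul_comm, ← add_smul, smul_add,
        smul_comm (μ : ℚ)]
      congr 3
      push_cast; ring
    have h2 : x₁div k * (F + (1 / ((k + 1) * (μ + k)) : ℚ) • (x 1 * D g F)) =
        (1 / (μ + k) : ℚ) • D g (x₁div (k + 1 : ℕ) * F) := by
      have h3 := x_one_mul_x₁div k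
      have h4 := D_x₁div_mul g hF' (k + 1 : ℕ)
      push_cast at h3 h4
      rw [add_sub_cancel_right] at h4
      push_cast
      rw [h4, add_sub_cancel_right, mul_add, mul_smul_comm, ← mul_assoc, mul_comm (x₁div k) (x 1),
        h3, smul_mul_assoc, smul_smul, smul_add, smul_smul]
      congr 1
      · rw [show (1 / (μ + k) * (k - -μ) : ℚ) = 1 by rw [sub_neg_eq_add]; field_simp; ring, one_smul]
      · congr 1; field_simp
    obtain ⟨u, hu, hFu⟩ := ih h1 (by rw [h2]; exact Submodule.smul_mem _ _ (D_mem_imD h))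
    refine ⟨u - (1 / ((k + 1) * (μ + k)) : ℚ) • D g F, ?_, ?_⟩
    · rw [map_sub, map_smul, hu, hDF, smul_sub, smul_comm]
    · convert hFu using 1
      rw [mul_sub, mul_smul_comm]
      abel

lemma hOp_monomial (g : ℕ) (m : ℕ+ →₀ ℕ) : hOp g (monomial m 1) =
    ((Finsupp.weight (fun i : ℕ+ => (i : ℚ) + 1) m) - g) • monomial m (1 : ℚ) := by
  obtain ⟨n, k, ν, hν, rfl⟩ := exists_eq_single_add_expo m
  rw [monomial_single_add_expo, map_smul, hOp_x₁div_mul g (hOp_prod_univ g hν), smul_comm, map_add,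
    weight_expo, Finsupp.weight_single]
  congr 1
  have h : ∀ i, (((ν i).toPNat' : ℕ) : ℚ) = ν i := fun i => by
    rw [Nat.toPNat'_coe, if_pos (one_pos.trans (hν i))]
  simp only [h]
  simp [Finset.sum_add_distrib]
  ring

lemma coeff_hOp (g : ℕ) (m : ℕ+ →₀ ℕ) (F : Poly) : coeff m (hOp g F) =
    ((Finsupp.weight (fun i : ℕ+ => (i : ℚ) + 1) m) - g) * coeff m F := by
  suffices h : lcoeff ℚ m ∘ₗ hOp g =
      ((Finsupp.weight (fun i : ℕ+ => (i : ℚ) + 1) m) - (g : ℚ)) • lcoeff ℚ m from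
    LinearMap.congr_fun h F
  refine (basisMonomials ℕ+ ℚ).ext fun m' => ?_
  simp only [coe_basisMonomials, LinearMap.comp_apply, LinearMap.smul_apply, lcoeff_apply]
  rw [hOp_monomial, coeff_smul, coeff_monomial]
  split_ifs with h
  · subst h; rfl
  · simp

lemma neg_one_zpow_eq {a b : ℤ} (h : Even (a - b)) : (-1 : ℚ) ^ a = (-1 : ℚ) ^ b := by
  rw [← sub_add_cancel a b, zpow_add₀ (by norm_num), h.neg_one_zpow, one_mul]

/-- Every monomial $x_1^nw$ of $F$ has $2n-c=\mu\le 0$, which forces $c\ge 0$, so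
`fourier_fourier_prod` applies to $w$. General eigenvectors are needed because the weight induction
leaves the monomials. -/
lemma fourier_fourier_of_nonpos {g : ℕ} {μ : ℤ} (hμ : μ ≤ 0) {F : Poly}
    (hF : hOp g F = (μ : ℚ) • F) : fourier g (fourier g F) - (-1 : ℚ) ^ μ • F ∈ imD g := by
  have key : ∀ m ∈ F.support,
      fourier g (fourier g (monomial m 1)) - (-1 : ℚ) ^ μ • monomial m (1 : ℚ) ∈ imD g := by
    intro m hm
    have hm' := mem_support_iff.mp hm
    have h1 := coeff_hOp g m F
    rw [hF, coeff_smul, smul_eq_mul] at h1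
    have h2 := mul_right_cancel₀ hm' h1
    obtain ⟨n, k, ν, hν, rfl⟩ := exists_eq_single_add_expo m
    have h : ∀ i, (((ν i).toPNat' : ℕ) : ℚ) = ν i := fun i => by
      rw [Nat.toPNat'_coe, if_pos (one_pos.trans (hν i))]
    rw [map_add, weight_expo, Finsupp.weight_single] at h2
    simp only [h] at h2
    have h3 : μ = 2 * n - ((g : ℤ) - ∑ i, (ν i : ℤ) - k) := by
      simp [Finset.sum_add_distrib] at h2
      have : (μ : ℚ) = ((2 * n - ((g : ℤ) - ∑ i, (ν i : ℤ) - k) : ℤ) : ℚ) := by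
        rw [h2]; push_cast; ring
      exact_mod_cast this
    obtain ⟨c, hc⟩ := Int.eq_ofNat_of_zero_le
      (show 0 ≤ (g : ℤ) - ∑ i, (ν i : ℤ) - k by omega)
    have hsign : (-1 : ℚ) ^ μ = (-1 : ℚ) ^ c := by
      rw [← zpow_natCast]
      exact neg_one_zpow_eq ⟨n - c, by rw [h3, hc]; ring⟩
    rw [hsign, ← mul_one (1 : ℚ), ← monomial_mul, mul_one, monomial_expo, ← X_pow_eq_monomial,
      ← x_pnat, PNat.one_coe]
    clear h2 h3 h1 hm hm'
    induction n with
    | zero =>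
      rw [pow_zero, one_mul, fourier_fourier_prod g hν hc, sub_self]
      exact zero_mem _
    | succ n ih =>
      rw [pow_succ', mul_assoc]
      exact fourier_fourier_x_one_mul_sub ih
  have h1 : fourier g (fourier g F) - (-1 : ℚ) ^ μ • F = ∑ m ∈ F.support, coeff m F •
      (fourier g (fourier g (monomial m 1)) - (-1 : ℚ) ^ μ • monomial m (1 : ℚ)) := by
    conv_lhs => rw [F.as_sum]
    simp only [map_sum, Finset.smul_sum, ← Finset.sum_sub_distrib, smul_sub]
    refine Finset.sum_congr rfl fun m _ => ?_
    rw [← mul_one (coeff m F), ← smul_eq_mul, ← smul_monomial, map_smul, map_smul, smul_comm,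
      smul_eq_mul, mul_one]
  rw [h1]
  exact sum_mem fun m hm => Submodule.smul_mem _ _ (key m hm)

lemma fourier_fourier_sub_mem {g : ℕ} (N : ℕ) : ∀ {μ : ℤ}, μ ≤ N → ∀ {F : Poly},
    hOp g F = (μ : ℚ) • F → fourier g (fourier g F) - (-1 : ℚ) ^ μ • F ∈ imD g := by
  induction N with
  | zero => intro μ hμ F hF; exact fourier_fourier_of_nonpos hμ hF
  | succ N ih =>
    intro μ hμ F hF
    rcases le_or_gt μ 0 with h | h
    · exact fourier_fourier_of_nonpos h hF
    · obtain ⟨u, hu, hFu⟩ := exists_sub_x_one_mul_mem (show 1 ≤ μ by omega) (g + 1) hF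
        (x₁div_mul_mem_imD g F)
      have h1 := fourier_fourier_x_one_mul_sub (ih (show μ - 2 ≤ N by push_cast at hμ; omega) hu)
      rw [neg_one_zpow_eq (b := μ) ⟨-1, by ring⟩] at h1
      have h2 := sub_mem (fourier_mem_imD (fourier_mem_imD hFu))
        (Submodule.smul_mem _ ((-1 : ℚ) ^ μ) hFu)
      have h3 := add_mem h1 h2
      convert h3 using 1
      rw [map_sub, map_sub, smul_sub]
      abel

lemma fourier_fourier_x₁div_mul_prod (g n : ℕ) {k : ℕ} {ν : Fin k → ℕ} (hν : ∀ i, 1 < ν i) :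
    fourier g (fourier g (x₁div n * ∏ i, x (ν i))) -
      (-1 : ℚ) ^ (g + k + ∑ i, ν i) • (x₁div n * ∏ i, x (ν i)) ∈ imD g := by
  have h1 := hOp_x₁div_mul g (hOp_prod_univ g hν) n
  have h2 := fourier_fourier_sub_mem (g := g) (μ := 2 * n - ((g : ℤ) - ∑ i, (ν i : ℤ) - k))
    _ (Int.self_le_toNat _) (by rw [h1]; push_cast; rfl)
  rw [← zpow_natCast]
  rwa [neg_one_zpow_eq (b := ((g + k + ∑ i, ν i : ℕ) : ℤ)) ⟨n - g, by push_cast; ring⟩] at h2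

/-! ### The representation of $\mathfrak{sl}_2$ -/

/-- The representation of `sl₂` defined by operators `e`, `f`, `h` with the relations of the
standard basis. -/
def sl₂Rep {M : Type*} [AddCommGroup M] [Module ℚ M] (e f h : Module.End ℚ M)
    (hef : e * f = f * e + h) (hhe : h * e = e * h + (2 : ℚ) • e)
    (hhf : h * f = f * h - (2 : ℚ) • f) : sl₂ →ₗ⁅ℚ⁆ Module.End ℚ M where
  toFun A := A.1 0 1 • e + A.1 1 0 • f + A.1 0 0 • h
  map_add' A B := by
    refine LinearMap.ext fun v => ?_
    simp
    module
  map_smul' c A := by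
    refine LinearMap.ext fun v => ?_
    simp
    module
  map_lie' {A B} := by
    have htr : ∀ A : sl₂, A.1 1 1 = -A.1 0 0 := fun A => by
      have h : Matrix.trace A.1 = 0 := A.2
      rw [Matrix.trace_fin_two] at h
      linarith
    refine LinearMap.ext fun v => ?_
    have h1 : e (f v) = f (e v) + h v := LinearMap.congr_fun hef v
    have h2 : h (e v) = e (h v) + (2 : ℚ) • e v := LinearMap.congr_fun hhe v
    have h3 : h (f v) = f (h v) - (2 : ℚ) • f v := LinearMap.congr_fun hhf v
    simp [Ring.lie_def, Matrix.mul_apply, Fin.sum_univ_two, htr, h1, h2, h3]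
    module

section

variable {M : Type*} [AddCommGroup M] [Module ℚ M] (e f h : Module.End ℚ M)
    (hef : e * f = f * e + h) (hhe : h * e = e * h + (2 : ℚ) • e)
    (hhf : h * f = f * h - (2 : ℚ) • f)

lemma sl₂Rep_apply (A : sl₂) :
    sl₂Rep e f h hef hhe hhf A = A.1 0 1 • e + A.1 1 0 • f + A.1 0 0 • h := rfl

lemma sl₂Rep_E : sl₂Rep e f h hef hhe hhf E = e := by
  simp [sl₂Rep_apply, E]

lemma sl₂Rep_Fm : sl₂Rep e f h hef hhe hhf Fm = f := by
  simp [sl₂Rep_apply, Fm]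

lemma sl₂Rep_H : sl₂Rep e f h hef hhe hhf H = h := by
  simp [sl₂Rep_apply, H]

end

lemma eOp_mul_fOp (g : ℕ) : eOp * fOp g = fOp g * eOp + hOp g := by
  refine LinearMap.ext fun F => ?_
  change x 1 * -(D g F) = -(D g (x 1 * F)) + hOp g F
  rw [D_x_one_mul]; ring

lemma hOp_mul_eOp (g : ℕ) : hOp g * eOp = eOp * hOp g + (2 : ℚ) • eOp := by
  refine LinearMap.ext fun F => ?_
  change hOp g (x 1 * F) = x 1 * hOp g F + (2 : ℚ) • (x 1 * F)
  rw [hOp_x_mul g one_pos]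
  congr 2
  norm_num

lemma hOp_mul_fOp (g : ℕ) : hOp g * fOp g = fOp g * hOp g - (2 : ℚ) • fOp g := by
  refine LinearMap.ext fun F => ?_
  change hOp g (-(D g F)) = -(D g (hOp g F)) - (2 : ℚ) • -(D g F)
  rw [map_neg, hOp_D, neg_sub, smul_neg]
  abel

/-! ### Passage to the quotient by `I g` -/

lemma eOp_mem_I (g : ℕ) : I g ≤ (I g).comap eOp := fun F hF => by
  change x 1 * F ∈ I g
  rw [I_eq_imD] at hF ⊢
  exact mul_mem_imD _ hF

lemma fOp_mem_I (g : ℕ) : I g ≤ (I g).comap (fOp g) := fun F hF => by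
  change -(D g F) ∈ I g
  rw [I_eq_imD] at hF ⊢
  exact neg_mem (D_mem_imD hF)

lemma hOp_mem_I (g : ℕ) : I g ≤ (I g).comap (hOp g) := fun F hF => by
  change hOp g F ∈ I g
  rw [I_eq_imD] at hF ⊢
  exact hOp_mem_imD hF

lemma fourier_mem_I (g : ℕ) : I g ≤ (I g).comap (fourier g) := fun F hF => by
  change fourier g F ∈ I g
  rw [I_eq_imD] at hF ⊢
  exact fourier_mem_imD hF

/-- `I_g` as an ideal. -/
def idealI (g : ℕ) : Ideal Poly where
  carrier := I g
  add_mem' := (I g).add_mem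
  zero_mem' := (I g).zero_mem
  smul_mem' P F hF := by
    change P * F ∈ I g
    change F ∈ I g at hF
    rw [I_eq_imD] at hF ⊢
    exact mul_mem_imD P hF

lemma mem_idealI (g : ℕ) (F : Poly) : F ∈ idealI g ↔ F ∈ I g := Iff.rfl

/-- The representation of `sl₂` on `Poly`. -/
def polyRep (g : ℕ) : sl₂ →ₗ⁅ℚ⁆ Module.End ℚ Poly :=
  sl₂Rep eOp (fOp g) (hOp g) (eOp_mul_fOp g) (hOp_mul_eOp g) (hOp_mul_fOp g)

/-- The representation of `sl₂` on the quotient by `I_g`. -/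
def quotRep (g : ℕ) : sl₂ →ₗ⁅ℚ⁆ Module.End ℚ (R g) :=
  sl₂Rep ((I g).mapQ (I g) eOp (eOp_mem_I g)) ((I g).mapQ (I g) (fOp g) (fOp_mem_I g))
    ((I g).mapQ (I g) (hOp g) (hOp_mem_I g))
    (by
      refine Submodule.linearMap_qext _ (LinearMap.ext fun F => ?_)
      exact congrArg (I g).mkQ (LinearMap.congr_fun (eOp_mul_fOp g) F))
    (by
      refine Submodule.linearMap_qext _ (LinearMap.ext fun F => ?_)
      exact congrArg (I g).mkQ (LinearMap.congr_fun (hOp_mul_eOp g) F))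
    (by
      refine Submodule.linearMap_qext _ (LinearMap.ext fun F => ?_)
      exact congrArg (I g).mkQ (LinearMap.congr_fun (hOp_mul_fOp g) F))

lemma quotRep_mkQ (g : ℕ) (A : sl₂) (F : Poly) :
    quotRep g A ((I g).mkQ F) = (I g).mkQ (polyRep g A F) := rfl

lemma polyRep_mem_I (g : ℕ) (A : sl₂) {F : Poly} (hF : F ∈ I g) : polyRep g A F ∈ I g :=
  add_mem (add_mem (Submodule.smul_mem _ _ (eOp_mem_I g hF))
    (Submodule.smul_mem _ _ (fOp_mem_I g hF))) (Submodule.smul_mem _ _ (hOp_mem_I g hF))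

/-- The Fourier operator on the quotient by `I_g`. -/
def quotFourier (g : ℕ) : R g →ₗ[ℚ] R g := (I g).mapQ (I g) (fourier g) (fourier_mem_I g)

lemma quotFourier_mkQ (g : ℕ) (F : Poly) :
    quotFourier g ((I g).mkQ F) = (I g).mkQ (fourier g F) := rfl

lemma quotFourier_quotFourier (g n : ℕ) {k : ℕ} {ν : Fin k → ℕ} (hν : ∀ i, 1 < ν i) :
    quotFourier g (quotFourier g ((I g).mkQ (x₁div n * ∏ i, x (ν i)))) =
      (-1 : ℚ) ^ (g + k + ∑ i, ν i) • (I g).mkQ (x₁div n * ∏ i, x (ν i)) := by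
  rw [quotFourier_mkQ, quotFourier_mkQ, ← map_smul]
  refine (Submodule.Quotient.eq _).mpr ?_
  rw [I_eq_imD]
  exact fourier_fourier_x₁div_mul_prod g n hν

lemma quot_linearMap_ext {g : ℕ} {M : Type*} [AddCommGroup M] [Module ℚ M] {A B : R g →ₗ[ℚ] M}
    (h : ∀ (n k : ℕ) (ν : Fin k → ℕ), (∀ i, 1 < ν i) →
      A ((I g).mkQ (x₁div n * ∏ i, x (ν i))) = B ((I g).mkQ (x₁div n * ∏ i, x (ν i)))) : A = B :=
  Submodule.linearMap_qext _ (linearMap_ext h)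

/-- The square is a sign on each spanning monomial. The cube is therefore the inverse. -/
lemma quotFourier_pow_four (g : ℕ) :
    quotFourier g ∘ₗ quotFourier g ∘ₗ quotFourier g ∘ₗ quotFourier g = LinearMap.id := by
  refine quot_linearMap_ext fun n k ν hν => ?_
  simp only [LinearMap.comp_apply, LinearMap.id_apply]
  rw [quotFourier_quotFourier g n hν, map_smul, map_smul, quotFourier_quotFourier g n hν, smul_smul,
    ← pow_add, Even.neg_one_pow ⟨_, rfl⟩, one_smul]

/-- The Fourier operator on the quotient by `I_g`, as an automorphism. -/
def fourierEquiv (g : ℕ) : R g ≃ₗ[ℚ] R g :=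
  LinearEquiv.ofLinearMap (quotFourier g) (quotFourier g ∘ₗ quotFourier g ∘ₗ quotFourier g)
    (quotFourier_pow_four g) (quotFourier_pow_four g)

lemma fourierFormula_quotFourier (g : ℕ) : FourierFormula g (quotFourier g) := by
  intro n k ν hν
  rw [quotFourier_mkQ, fourier_x₁div_mul_prod g n hν, map_smul, smul_smul, ← pow_add,
    Even.neg_one_pow ⟨_, rfl⟩, one_smul]

lemma FourierFormula.eq {g : ℕ} {S T : R g →ₗ[ℚ] R g} (hS : FourierFormula g S)
    (hT : FourierFormula g T) : S = T := by
  refine quot_linearMap_ext fun n k ν hν => ?_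
  have h := (hS n k ν hν).trans (hT n k ν hν).symm
  exact smul_right_injective _ (pow_ne_zero n (by norm_num : (-1 : ℚ) ≠ 0)) h

lemma quotFourier_comp_eOp (g : ℕ) :
    quotFourier g ∘ₗ quotRep g E = -quotRep g Fm ∘ₗ quotFourier g := by
  rw [quotRep, sl₂Rep_E, sl₂Rep_Fm]
  refine Submodule.linearMap_qext _ (LinearMap.ext fun F => ?_)
  change (I g).mkQ (fourier g (x 1 * F)) = -(I g).mkQ (-(D g (fourier g F)))
  rw [fourier_x_one_mul, map_neg, neg_neg]

lemma quotFourier_comp_fOp (g : ℕ) :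
    quotFourier g ∘ₗ quotRep g Fm = -quotRep g E ∘ₗ quotFourier g := by
  rw [quotRep, sl₂Rep_E, sl₂Rep_Fm]
  refine Submodule.linearMap_qext _ (LinearMap.ext fun F => ?_)
  change (I g).mkQ (fourier g (-(D g F))) = -(I g).mkQ (x 1 * fourier g F)
  rw [map_neg, map_neg, neg_inj]
  refine (Submodule.Quotient.eq _).mpr ?_
  rw [I_eq_imD]
  exact fourier_D_sub_mem g F

lemma quotFourier_comp_hOp (g : ℕ) :
    quotFourier g ∘ₗ quotRep g H = -quotRep g H ∘ₗ quotFourier g := by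
  rw [quotRep, sl₂Rep_H]
  refine Submodule.linearMap_qext _ (LinearMap.ext fun F => ?_)
  change (I g).mkQ (fourier g (hOp g F)) = -(I g).mkQ (hOp g (fourier g F))
  rw [hOp_fourier, map_neg, neg_neg]

lemma comp_fourierEquiv_symm {g : ℕ} {A B : Module.End ℚ (R g)}
    (h : quotFourier g ∘ₗ A = B ∘ₗ quotFourier g) :
    (fourierEquiv g).toLinearMap ∘ₗ A ∘ₗ (fourierEquiv g).symm.toLinearMap = B := by
  refine LinearMap.ext fun v => ?_
  obtain ⟨w, rfl⟩ := (fourierEquiv g).surjective v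
  simp only [LinearMap.comp_apply, LinearEquiv.coe_coe, LinearEquiv.symm_apply_apply]
  exact LinearMap.congr_fun h w

lemma x_one_pow (n : ℕ) : x 1 ^ n = (n.factorial : ℚ) • x₁div n := by
  rw [x₁div_natCast, smul_smul, mul_one_div_cancel (by positivity), one_smul]

end

end JacobianRing

theorem theorem3 (g : ℕ) (hg : 2 ≤ g) :
    -- (i)
    JacobianRing.I g = ⨅ (n : ℕ) (_ : 1 ≤ n), LinearMap.range (JacobianRing.D g ^ n) ∧
    -- (ii)
    (∃ J : Ideal JacobianRing.Poly, (∀ F, F ∈ J ↔ F ∈ JacobianRing.I g) ∧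
      ∃ φ : JacobianRing.R g ≃ₗ[ℚ] (JacobianRing.Poly ⧸ J),
        ∀ F, φ ((JacobianRing.I g).mkQ F) = Ideal.Quotient.mk J F) ∧
    -- (iii) and (iv)
    (∃ ρ : JacobianRing.sl₂ →ₗ⁅ℚ⁆ Module.End ℚ JacobianRing.Poly,
      ρ JacobianRing.E = JacobianRing.eOp ∧
      ρ JacobianRing.Fm = JacobianRing.fOp g ∧
      ρ JacobianRing.H = JacobianRing.hOp g ∧
      (∀ A, ∀ F ∈ JacobianRing.I g, ρ A F ∈ JacobianRing.I g) ∧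
      ∃ ρR : JacobianRing.sl₂ →ₗ⁅ℚ⁆ Module.End ℚ (JacobianRing.R g),
        (∀ A F, ρR A ((JacobianRing.I g).mkQ F) = (JacobianRing.I g).mkQ (ρ A F)) ∧
        ∃ S : JacobianRing.R g ≃ₗ[ℚ] JacobianRing.R g,
          JacobianRing.FourierFormula g S.toLinearMap ∧
          (∀ T : JacobianRing.R g →ₗ[ℚ] JacobianRing.R g,
            JacobianRing.FourierFormula g T → T = S.toLinearMap) ∧
          (∀ (n k : ℕ) (ν : Fin k → ℕ), (∀ i, 1 < ν i) →
            S (S ((JacobianRing.I g).mkQ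
              (JacobianRing.x 1 ^ n * ∏ i, JacobianRing.x (ν i)))) =
            (-1 : ℚ) ^ (g + k + ∑ i, ν i) • (JacobianRing.I g).mkQ
              (JacobianRing.x 1 ^ n * ∏ i, JacobianRing.x (ν i))) ∧
          S.toLinearMap ∘ₗ ρR JacobianRing.E ∘ₗ S.symm.toLinearMap = -ρR JacobianRing.Fm ∧
          S.toLinearMap ∘ₗ ρR JacobianRing.Fm ∘ₗ S.symm.toLinearMap = -ρR JacobianRing.E ∧
          S.toLinearMap ∘ₗ ρR JacobianRing.H ∘ₗ S.symm.toLinearMap = -ρR JacobianRing.H) := by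
  refine ⟨JacobianRing.I_eq_imD g, ⟨JacobianRing.idealI g, JacobianRing.mem_idealI g,
    (Submodule.quotEquivOfEq _ ((JacobianRing.idealI g).restrictScalars ℚ) rfl).trans
      (Submodule.Quotient.restrictScalarsEquiv ℚ (JacobianRing.idealI g)), fun F => rfl⟩,
    JacobianRing.polyRep g, JacobianRing.sl₂Rep_E .., JacobianRing.sl₂Rep_Fm ..,
    JacobianRing.sl₂Rep_H .., fun A F => JacobianRing.polyRep_mem_I g A, JacobianRing.quotRep g,
    JacobianRing.quotRep_mkQ g, JacobianRing.fourierEquiv g,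
    JacobianRing.fourierFormula_quotFourier g,
    fun T hT => hT.eq (JacobianRing.fourierFormula_quotFourier g), fun n k ν hν => ?_,
    JacobianRing.comp_fourierEquiv_symm (JacobianRing.quotFourier_comp_eOp g),
    JacobianRing.comp_fourierEquiv_symm (JacobianRing.quotFourier_comp_fOp g),
    JacobianRing.comp_fourierEquiv_symm (JacobianRing.quotFourier_comp_hOp g)⟩
  rw [JacobianRing.x_one_pow, smul_mul_assoc, map_smul, map_smul, map_smul, smul_comm]
  congr 1
  exact JacobianRing.quotFourier_quotFourier g n hν
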